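/- Let $\mathfrak g$ be a finite-dimensional complex semisimple Lie algebra with a nondegenerate symmetric invariant bilinear form $B$ (not necessarily the Killing form), i.e. $B([X,Y],Z)=-B(Y,[X,Z])$. Notation. $\Lambda\mathfrak g=\bigoplus_{k\ge 0}\Lambda^k\mathfrak g$ is the Grassmann algebra of skew-symmetric multilinear forms on $\mathfrak g$, with the wedge product; $\iota_X\Omega(Y_1,\dots,Y_k)=\Omega(X,Y_1,\dots,Y_k)$ and $\iota_X 1=0$; $\theta_X\Omega(Y_1,\dots,Y_k)=-\sum_i\Omega(Y_1,\dots,[X,Y_i],\dots,Y_k)$; and $(\Lambda\mathfrak g)^{\mathfrak g}=\{\Omega : \theta_X\Omega=0\ \forall X\in\mathfrak g\}$. The super Poisson bracket on $\Lambda\mathfrak g$ is the bilinear map given, in any orthonormal basis $X_1,\dots,X_n$ of $(\mathfrak g,B)$, by $$\{\Omega,\Omega'\}=2(-1)^{w+1}\sum_{j=1}^n\iota_{X_j}(\Omega)\wedge\iota_{X_j}(\Omega'),\qquad \Omega\in\Lambda^w\mathfrak g,\ \Omega'\in\Lambda\mathfrak g.$$ $\mathcal M_a=\bigoplus_{k\ge0}\mathcal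 M_a^k$ is the space of skew-symmetric multilinear maps $\mathfrak g^k\to\mathfrak g$ ($\mathcal M_a^0=\mathfrak g$), with $\mathfrak g$-action $L_XC(Y_1,\dots,Y_k)=[X,C(Y_1,\dots,Y_k)]-\sum_iC(Y_1,\dots,[X,Y_i],\dots,Y_k)$ and with the Gerstenhaber bracket, which for $F\in\mathcal M_a^{p+1}$, $G\in\mathcal M_a^{q+1}$ is $$[F,G]_a(X_1,\dots,X_{p+q+1})=(-1)^{pq}\sum_{\sigma\in\mathfrak S_{q+1,p}}\varepsilon(\sigma)F(G(X_{\sigma(1)},\dots,X_{\sigma(q+1)}),X_{\sigma(q+2)},\dots)-\sum_{\sigma\in\mathfrak S_{p+1,q}}\varepsilon(\sigma)G(F(X_{\sigma(1)},\dots,X_{\sigma(p+1)}),X_{\sigma(p+2)},\dots),$$ where $\mathfrak S_{r,s}$ is the set of $(r,s)$-unshuffles and a sum is $0$ if its outer map has no argument. A cochain $C\in\mathcal M_a^k$ is cyclic if $\hat C(Y_1,\dots,Y_{k+1})=B(C(Y_1,\dots,Y_k),Y_{k+1})$ satisfies $\hat C(Y_1,\dots,Y_{k+1})=(-1)^k\hat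 C(Y_{k+1},Y_1,\dots,Y_k)$; $\mathcal C_c(\mathfrak g)\subset\mathcal M_a$ is the graded space of cyclic cochains. With $F_0(X,Y)=[X,Y]$ and $d=[F_0,\cdot]_a$, the cyclic cohomology $H_c^*(\mathfrak g)$ is the cohomology of the complex $(\mathcal C_c(\mathfrak g),d)$. Then: 1. $\{I,I'\}=0$ for all $I,I'\in(\Lambda\mathfrak g)^{\mathfrak g}$. 2. Consequently, $[C,C']_a=0$ for all $\mathfrak g$-invariant cyclic cochains $C,C'\in\mathcal C_c(\mathfrak g)^{\mathfrak g}$, and the Gerstenhaber bracket induces the zero bracket on $H_c^*(\mathfrak g)$: the bracket of two cyclic cocycles is a cyclic cocycle, there is a unique bilinear bracket on $H_c^*(\mathfrak g)$ with $[[F],[G]]=[[F,G]_a]$, and it is identically zero. -/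

import Mathlib

open scoped DirectSum TensorProduct

noncomputable section

namespace QuadraticLie

/-- The graded space `⨁ₖ {skew-symmetric k-linear maps 𝔤ᵏ → N}`. -/
def Skew (𝔤 N : Type*) [AddCommGroup 𝔤] [Module ℂ 𝔤] [AddCommGroup N] [Module ℂ N] : Type _ :=
  ⨁ k : ℕ, (𝔤 [⋀^Fin k]→ₗ[ℂ] N)

section Skew

variable {𝔤 N M : Type*} [AddCommGroup 𝔤] [Module ℂ 𝔤] [AddCommGroup N] [Module ℂ N]
  [AddCommGroup M] [Module ℂ M]

instance : AddCommGroup (Skew 𝔤 N) :=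
  inferInstanceAs (AddCommGroup (⨁ k : ℕ, (𝔤 [⋀^Fin k]→ₗ[ℂ] N)))

instance : Module ℂ (Skew 𝔤 N) :=
  inferInstanceAs (Module ℂ (⨁ k : ℕ, (𝔤 [⋀^Fin k]→ₗ[ℂ] N)))

/-- The inclusion of the homogeneous elements of degree `k`. -/
def Skew.of (k : ℕ) : (𝔤 [⋀^Fin k]→ₗ[ℂ] N) →ₗ[ℂ] Skew 𝔤 N :=
  DirectSum.lof ℂ ℕ (fun k => 𝔤 [⋀^Fin k]→ₗ[ℂ] N) k

/-- The homogeneous component of degree `k`. -/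
def Skew.component (k : ℕ) : Skew 𝔤 N →ₗ[ℂ] (𝔤 [⋀^Fin k]→ₗ[ℂ] N) :=
  DirectSum.component ℂ ℕ (fun k => 𝔤 [⋀^Fin k]→ₗ[ℂ] N) k

/-- The linear map with prescribed restrictions to the homogeneous components. -/
def Skew.lift (f : (k : ℕ) → (𝔤 [⋀^Fin k]→ₗ[ℂ] N) →ₗ[ℂ] M) : Skew 𝔤 N →ₗ[ℂ] M :=
  DirectSum.toModule ℂ ℕ M f

end Skew

/-- The Grassmann algebra `Λ𝔤`: skew-symmetric multilinear forms on `𝔤`. -/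
abbrev Grassmann (𝔤 : Type*) [AddCommGroup 𝔤] [Module ℂ 𝔤] : Type _ := Skew 𝔤 ℂ

/-- The space `M_a(𝔤)` of skew-symmetric multilinear maps from `𝔤` to `𝔤`
(in degree `0` these are the elements of `𝔤`). -/
abbrev Cochains (𝔤 : Type*) [AddCommGroup 𝔤] [Module ℂ 𝔤] : Type _ := Skew 𝔤 𝔤

section Multilinear

variable {𝔤 N N₁ N₂ N₃ : Type*} [AddCommGroup 𝔤] [Module ℂ 𝔤]
  [AddCommGroup N] [Module ℂ N] [AddCommGroup N₁] [Module ℂ N₁] [AddCommGroup N₂] [Module ℂ N₂]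
  [AddCommGroup N₃] [Module ℂ N₃]

/-- For a bilinear map `f`, the sum over `(k,l)`-unshuffles
`(Y₁, …, Yₖ₊ₗ) ↦ ∑ ε(σ) f (a (Y_σ(1), …, Y_σ(k))) (b (Y_σ(k+1), …, Y_σ(k+l)))`. -/
def shuffleProd (f : N₁ →ₗ[ℂ] N₂ →ₗ[ℂ] N₃) (k l : ℕ) :
    (𝔤 [⋀^Fin k]→ₗ[ℂ] N₁) →ₗ[ℂ] (𝔤 [⋀^Fin l]→ₗ[ℂ] N₂) →ₗ[ℂ] (𝔤 [⋀^Fin (k + l)]→ₗ[ℂ] N₃) :=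
  LinearMap.mk₂ ℂ
    (fun a b => ((TensorProduct.lift f).compAlternatingMap (a.domCoprod b)).domDomCongr
      finSumFinEquiv)
    (fun a a' b => by
      simp only [← AlternatingMap.domCoprod'_apply, TensorProduct.add_tmul, map_add]
      ext v; simp)
    (fun c a b => by
      simp only [← AlternatingMap.domCoprod'_apply, ← TensorProduct.smul_tmul', map_smul]
      ext v; simp)
    (fun a b b' => by
      simp only [← AlternatingMap.domCoprod'_apply, TensorProduct.tmul_add, map_add]
      ext v; simp)
    (fun c a b => by
      simp only [← AlternatingMap.domCoprod'_apply, TensorProduct.tmul_smul, map_smul]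
      ext v; simp)

/-- The wedge product on `Λ𝔤`. -/
def wedge : Grassmann 𝔤 →ₗ[ℂ] Grassmann 𝔤 →ₗ[ℂ] Grassmann 𝔤 :=
  Skew.lift fun k => LinearMap.flip <|
    Skew.lift fun l => LinearMap.flip <|
      (shuffleProd (LinearMap.mul ℂ ℂ) k l).compr₂ (Skew.of (k + l))

/-- The homogeneous components of `ι_X`. -/
def contractAux (X : 𝔤) : (k : ℕ) → (𝔤 [⋀^Fin k]→ₗ[ℂ] ℂ) →ₗ[ℂ] Grassmann 𝔤
  | 0 => 0
  | k + 1 => Skew.of k ∘ₗ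
      (AlternatingMap.curryLeftLinearMap (R := ℂ) (M := 𝔤) (N := ℂ) (n := k)).flip X

/-- The interior product `ι_X Ω (Y₁, …, Yₖ) = Ω (X, Y₁, …, Yₖ)` on `Λ𝔤`, with `ι_X 1 = 0`. -/
def contract (X : 𝔤) : Grassmann 𝔤 →ₗ[ℂ] Grassmann 𝔤 :=
  Skew.lift (contractAux X)

/-- A basis `b` is orthonormal for the bilinear form `B`. -/
def IsOrthonormalBasis {ι : Type*} (B : LinearMap.BilinForm ℂ 𝔤)
    (b : Module.Basis ι ℂ 𝔤) : Prop :=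
  (∀ i, B (b i) (b i) = 1) ∧ ∀ i j, i ≠ j → B (b i) (b j) = 0

/-- Orthonormal bases exist for nondegenerate symmetric complex bilinear forms. -/
theorem exists_isOrthonormalBasis [FiniteDimensional ℂ 𝔤] (B : LinearMap.BilinForm ℂ 𝔤)
    (hs : B.IsSymm) (hn : B.Nondegenerate) :
    ∃ b : Module.Basis (Fin (Module.finrank ℂ 𝔤)) ℂ 𝔤, IsOrthonormalBasis B b := by
  obtain ⟨e⟩ := QuadraticForm.equivalent_weightedSumSquares_of_isAlgClosed
    (LinearMap.BilinMap.toQuadraticMap B) (by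
    have : QuadraticMap.associated (R := ℂ) (LinearMap.BilinMap.toQuadraticMap B) = B :=
      QuadraticMap.associated_left_inverse ℂ hs.eq
    rw [this]; exact hn.1)
  have h' : ∀ z, B (e.symm z) (e.symm z) = ∑ i, z i * z i := by
    intro z
    have h := e.symm.map_app z
    rw [LinearMap.BilinMap.toQuadraticMap_apply] at h
    rw [h, QuadraticMap.weightedSumSquares_apply]
    simp
  have key : ∀ x y, B (e.symm x) (e.symm y) = ∑ i, x i * y i := by
    intro x y
    have h1 := h' (x + y)
    have h2 := h' x
    have h3 := h' y
    have hc : B (e.symm y) (e.symm x) = B (e.symm x) (e.symm y) := hs.eq _ _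
    have he : e.symm (x + y) = e.symm x + e.symm y := map_add e.symm.toLinearEquiv x y
    rw [he] at h1
    simp only [map_add, LinearMap.add_apply, hc, h2, h3, Pi.add_apply] at h1
    have h4 : ∑ i, (x i + y i) * (x i + y i) =
        ∑ i, x i * x i + ∑ i, y i * y i + 2 * ∑ i, x i * y i := by
      rw [Finset.mul_sum, ← Finset.sum_add_distrib, ← Finset.sum_add_distrib]
      exact Finset.sum_congr rfl fun i _ => by ring
    rw [h4] at h1
    linear_combination (1/2) * h1
  refine ⟨(Pi.basisFun ℂ _).map e.symm.toLinearEquiv, ?_, ?_⟩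
  · intro i
    have := key (Pi.single i 1) (Pi.single i 1)
    simpa [Pi.single_apply] using this
  · intro i j hij
    have := key (Pi.single i 1) (Pi.single j 1)
    simpa [Pi.single_apply, hij, hij.symm] using this

/-- The super Poisson bracket on `Λ𝔤`, written in an orthonormal basis `b` of `𝔤`:
`{Ω, Ω'} = 2 (-1)^(w+1) ∑ⱼ ι_{bⱼ} Ω ∧ ι_{bⱼ} Ω'` for `Ω` of degree `w`, extended bilinearly. -/
def superPoisson {ι : Type*} [Fintype ι] (b : Module.Basis ι ℂ 𝔤) :
    Grassmann 𝔤 →ₗ[ℂ] Grassmann 𝔤 →ₗ[ℂ] Grassmann 𝔤 :=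
  Skew.lift fun w => ((2 : ℂ) * (-1) ^ (w + 1)) •
    ∑ j, wedge.compl₁₂ (contract (b j) ∘ₗ Skew.of w) (contract (b j))

/-- `flipCurry F (Y₁, …, Yₖ) = (Z ↦ F (Z, Y₁, …, Yₖ))`. -/
def flipCurry (k : ℕ) :
    (𝔤 [⋀^Fin (k + 1)]→ₗ[ℂ] N) →ₗ[ℂ] (𝔤 [⋀^Fin k]→ₗ[ℂ] (𝔤 →ₗ[ℂ] N)) where
  toFun F :=
    { toFun := fun v =>
        { toFun := fun Z => F.curryLeft Z v
          map_add' := fun Z Z' => by rw [map_add, AlternatingMap.add_apply]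
          map_smul' := fun c Z => by rw [map_smul, AlternatingMap.smul_apply, RingHom.id_apply] }
      map_update_add' := fun {_} v i x y => by
        ext Z
        exact (F.curryLeft Z).toMultilinearMap.map_update_add' v i x y
      map_update_smul' := fun {_} v i c x => by
        ext Z
        exact (F.curryLeft Z).toMultilinearMap.map_update_smul' v i c x
      map_eq_zero_of_eq' := fun v i j h hij => by
        ext Z
        exact (F.curryLeft Z).map_eq_zero_of_eq v h hij }
  map_add' _ _ := rfl
  map_smul' _ _ := rfl

variable (𝔤) in
/-- The evaluation pairing `(Z, T) ↦ T Z` of `𝔤` with `End 𝔤`. -/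
def evalPairing : 𝔤 →ₗ[ℂ] (𝔤 →ₗ[ℂ] 𝔤) →ₗ[ℂ] 𝔤 :=
  (LinearMap.id : (𝔤 →ₗ[ℂ] 𝔤) →ₗ[ℂ] (𝔤 →ₗ[ℂ] 𝔤)).flip

/-- The insertion of `G` (with `l` arguments) into the first slot of `F` (with `k` arguments):
`(X₁, …, Xₖ₊ₗ₋₁) ↦ ∑ ε(σ) F (G (X_σ(1), …, X_σ(l)), X_σ(l+1), …, X_σ(k+l-1))`, summed over
`(l, k-1)`-unshuffles, and `0` if `k = 0`. -/
def insertion : (k l : ℕ) →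
    (𝔤 [⋀^Fin k]→ₗ[ℂ] 𝔤) →ₗ[ℂ] (𝔤 [⋀^Fin l]→ₗ[ℂ] 𝔤) →ₗ[ℂ] Cochains 𝔤
  | 0, _ => 0
  | k + 1, l => ((shuffleProd (𝔤 := 𝔤) (evalPairing 𝔤) l k).flip ∘ₗ
      flipCurry (𝔤 := 𝔤) (N := 𝔤) k).compr₂ (Skew.of (l + k))

/-- The homogeneous components of `gBracket`. -/
def gBracketAux (k l : ℕ) :
    (𝔤 [⋀^Fin k]→ₗ[ℂ] 𝔤) →ₗ[ℂ] (𝔤 [⋀^Fin l]→ₗ[ℂ] 𝔤) →ₗ[ℂ] Cochains 𝔤 :=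
  ((-1 : ℂ) ^ ((k + 1) * (l + 1))) • insertion (𝔤 := 𝔤) k l - (insertion (𝔤 := 𝔤) l k).flip

/-- The Gerstenhaber (Nijenhuis-Richardson) bracket on `M_a(𝔤)`. For `F` with `k = p + 1`
arguments and `G` with `l = q + 1` arguments, `[F, G] (X₁, …, X_{p+q+1})` is
`(-1)^(pq) ∑ ε(σ) F (G (X_σ(1), …, X_σ(q+1)), X_σ(q+2), …, X_σ(p+q+1))`, summed over
`(q+1, p)`-unshuffles, minus
`∑ ε(σ) G (F (X_σ(1), …, X_σ(p+1)), X_σ(p+2), …, X_σ(p+q+1))`, summed over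
`(p+1, q)`-unshuffles (a sum is absent if its outer map has no argument); it is extended
bilinearly. Note that `pq` and `(k+1)(l+1)` have the same parity. -/
def gBracket : Cochains 𝔤 →ₗ[ℂ] Cochains 𝔤 →ₗ[ℂ] Cochains 𝔤 :=
  Skew.lift fun k => LinearMap.flip <|
    Skew.lift fun l => LinearMap.flip <| gBracketAux k l

/-- The form `Ĉ (Y₁, …, Yₖ₊₁) = B (C (Y₁, …, Yₖ), Yₖ₊₁)`. -/
def hat (B : LinearMap.BilinForm ℂ 𝔤) {k : ℕ} (C : 𝔤 [⋀^Fin k]→ₗ[ℂ] 𝔤) (Y : Fin (k + 1) → 𝔤) : ℂ :=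
  B (C fun i => Y i.castSucc) (Y (Fin.last k))

/-- The space `C_c(𝔤)` of cyclic cochains: those all of whose homogeneous components satisfy
`Ĉ (Y₁, …, Yₖ₊₁) = (-1)ᵏ Ĉ (Yₖ₊₁, Y₁, …, Yₖ)`. -/
def cyclicCochains (B : LinearMap.BilinForm ℂ 𝔤) : Submodule ℂ (Cochains 𝔤) where
  carrier := {C | ∀ (k : ℕ) (Y : Fin (k + 1) → 𝔤),
    hat B (Skew.component k C) Y =
      (-1) ^ k * hat B (Skew.component k C) (Fin.cons (Y (Fin.last k)) fun i => Y i.castSucc)}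
  zero_mem' := fun k Y => by simp [hat]
  add_mem' := fun {C D} hC hD k Y => by
    have h1 := hC k Y
    have h2 := hD k Y
    simp only [hat, AlternatingMap.add_apply, map_add,
      LinearMap.add_apply] at h1 h2 ⊢
    rw [h1, h2, mul_add]
  smul_mem' := fun c C hC k Y => by
    have h1 := hC k Y
    simp only [hat, AlternatingMap.smul_apply, map_smul,
      LinearMap.smul_apply, smul_eq_mul] at h1 ⊢
    rw [h1]
    ring

end Multilinear

section Lie

variable {𝔤 : Type*} [LieRing 𝔤] [LieAlgebra ℂ 𝔤]

/-- `Ω ∈ (Λ𝔤)^𝔤`: each homogeneous component satisfies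
`θ_X Ω (Y₁, …, Yₖ) = - ∑ᵢ Ω (Y₁, …, [X, Yᵢ], …, Yₖ) = 0`. -/
def IsInvariantForm (Ω : Grassmann 𝔤) : Prop :=
  ∀ (X : 𝔤) (k : ℕ) (Y : Fin k → 𝔤), -∑ i, Skew.component k Ω (Function.update Y i ⁅X, Y i⁆) = 0

/-- `C ∈ M_a(𝔤)^𝔤`: each homogeneous component satisfies
`L_X C (Y₁, …, Yₖ) = [X, C (Y₁, …, Yₖ)] - ∑ᵢ C (Y₁, …, [X, Yᵢ], …, Yₖ) = 0`. -/
def IsInvariantCochain (C : Cochains 𝔤) : Prop :=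
  ∀ (X : 𝔤) (k : ℕ) (Y : Fin k → 𝔤),
    ⁅X, Skew.component k C Y⁆ - ∑ i, Skew.component k C (Function.update Y i ⁅X, Y i⁆) = 0

variable (𝔤) in
/-- The Lie bracket `F₀ (X, Y) = [X, Y]` as a skew-symmetric bilinear map. -/
def lieCochain : 𝔤 [⋀^Fin 2]→ₗ[ℂ] 𝔤 where
  toFun v := ⁅v 0, v 1⁆
  map_update_add' := fun {inst} v i x y => by
    rw [Subsingleton.elim inst (instDecidableEqFin 2)]
    fin_cases i <;> simp
  map_update_smul' := fun {inst} v i c x => by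
    rw [Subsingleton.elim inst (instDecidableEqFin 2)]
    fin_cases i <;> simp
  map_eq_zero_of_eq' := fun v i j h hij => by
    fin_cases i <;> fin_cases j <;> simp_all

variable (𝔤) in
/-- The differential `d = [F₀, ·]` of the adjoint cohomology complex `M_a(𝔤)`. -/
def diff : Cochains 𝔤 →ₗ[ℂ] Cochains 𝔤 :=
  gBracket (Skew.of 2 (lieCochain 𝔤))

/-- Cyclic cocycles. -/
def cyclicCocycles (B : LinearMap.BilinForm ℂ 𝔤) : Submodule ℂ (Cochains 𝔤) :=
  cyclicCochains B ⊓ LinearMap.ker (diff 𝔤)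

/-- Cyclic coboundaries: the image of the cyclic cochains under `d`. -/
def cyclicCoboundaries (B : LinearMap.BilinForm ℂ 𝔤) : Submodule ℂ (Cochains 𝔤) :=
  (cyclicCochains B).map (diff 𝔤)

/-- The cyclic cohomology `H_c^*(𝔤)` (the sum over all degrees): the cohomology of the complex
of cyclic cochains. -/
abbrev CyclicCohomology (B : LinearMap.BilinForm ℂ 𝔤) : Type _ :=
  cyclicCocycles B ⧸ (cyclicCoboundaries B).submoduleOf (cyclicCocycles B)

/-- The class of a cyclic cocycle. -/
def cyclicClass (B : LinearMap.BilinForm ℂ 𝔤) : cyclicCocycles B →ₗ[ℂ] CyclicCohomology B :=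
  ((cyclicCoboundaries B).submoduleOf (cyclicCocycles B)).mkQ

/-- `β` is the bracket induced on `H_c^*(𝔤)` by the Gerstenhaber bracket: for cyclic cocycles
`F`, `G`, the cochain `[F, G]` is a cyclic cocycle and `β` of the classes of `F` and `G` is
its class. -/
def IsInducedBracket (B : LinearMap.BilinForm ℂ 𝔤)
    (β : CyclicCohomology B →ₗ[ℂ] CyclicCohomology B →ₗ[ℂ] CyclicCohomology B) : Prop :=
  ∀ F G : cyclicCocycles B, ∃ h : gBracket (F : Cochains 𝔤) (G : Cochains 𝔤) ∈ cyclicCocycles B,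
    β (cyclicClass B F) (cyclicClass B G) = cyclicClass B ⟨_, h⟩

end Lie

end QuadraticLie

end

/-! Write `x♯` for `sharp B hn x`, the `𝔤`-valued form obtained from a scalar form `x` by dualising
one argument through `B`. Cyclic cochains are exactly the forms `x♯`. With `⟨·,·⟩ = prod B` the
wedge product contracted by `B` and `eps` the parity sign, both brackets come from one pairing: `{x,
y} = 2⟨eps x♯, y♯⟩` (`superPoisson_eq`) and `[x♯, y♯]ₐ = ⟨eps x♯, y♯⟩♯` (`gBracket_sharp`).

The vanishing comes from the acyclicity of the adjoint complex. The Killing Casimir acts as the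
identity on `𝔤`, which gives an equivariant homotopy `h` with `d h + h d = 1` (`dAd_homotopy`). By
the Leibniz rule for `B`, if `F` and `G` are closed then `⟨eps F, G⟩ = -d⟨eps (h F), G⟩`
(`prod_form_eq_dTriv`).

If `x` and `y` are invariant, they are closed, since `2d = ∑ⱼ b^j ∧ θ_{bⱼ}`; hence `x♯` and `y♯` are
closed because `d x♯ = -(d x)♯`. The primitive above is invariant as well, hence closed, so the
pairing is `0`: this settles both statements about invariants. For arbitrary cyclic cocycles the
primitive `w = ⟨eps (h F), G⟩` gives `[F, G]ₐ = -(d w)♯ = d(w♯)` with `w♯` cyclic, so the bracket is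
a coboundary.

Identities between forms are proved throughout by one principle: a form is determined by its
degree-zero value and its interior products. Only the antiderivation rule `iota_prod` is computed
with permutations. -/

noncomputable section

namespace QuadraticLie

/-! ### Signed sums over permutations, split by the position of one argument -/

section PermSum

variable {V N : Type*} [AddCommGroup N] [Module ℂ N]

/-- The sign of a permutation as a complex number. -/
def csign {α : Type*} [DecidableEq α] [Fintype α] (σ : Equiv.Perm α) : ℂ :=
  ((Equiv.Perm.sign σ : ℤ) : ℂ)

/-- The index `p` is recovered as the preimage of `0`: `p.cycleRange` carries `p` to `0`, which the
other factor fixes. Injectivity follows, and both sides have `(n + 1)!` elements. -/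
theorem bijective_decomposeFin_mul_cycleRange (n : ℕ) :
    Function.Bijective fun q : Fin (n + 1) × Equiv.Perm (Fin n) =>
      Equiv.Perm.decomposeFin.symm (0, q.2) * q.1.cycleRange := by
  rw [Fintype.bijective_iff_injective_and_card]
  constructor
  · rintro ⟨p, τ⟩ ⟨p', τ'⟩ h
    simp only at h
    have hp : ∀ (p : Fin (n + 1)) (τ : Equiv.Perm (Fin n)),
        (Equiv.Perm.decomposeFin.symm (0, τ) * p.cycleRange) p = 0 := by
      intro p τ
      simp [Equiv.Perm.mul_apply]
    have h1 := hp p τ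
    rw [h] at h1
    have h2 : p = p' := (Equiv.Perm.decomposeFin.symm (0, τ') * p'.cycleRange).injective
      (h1.trans (hp p' τ').symm)
    subst h2
    have h3 := Equiv.Perm.decomposeFin.symm.injective (mul_right_cancel h)
    simpa using h3
  · simp [Fintype.card_perm, Nat.factorial_succ]

theorem sum_perm_cons {n : ℕ} (φ : (Fin (n + 1) → V) → N) (X : V) (w : Fin n → V) :
    ∑ σ : Equiv.Perm (Fin (n + 1)), csign σ • φ (Matrix.vecCons X w ∘ σ) =
      ∑ p : Fin (n + 1), ∑ τ : Equiv.Perm (Fin n),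
        ((-1 : ℂ) ^ (p : ℕ) * csign τ) • φ (p.insertNth X (w ∘ τ)) := by
  rw [← Fintype.sum_prod_type' (f := fun (p : Fin (n + 1)) (τ : Equiv.Perm (Fin n)) =>
    ((-1 : ℂ) ^ (p : ℕ) * csign τ) • φ (p.insertNth X (w ∘ τ)))]
  refine (Fintype.sum_bijective _ (bijective_decomposeFin_mul_cycleRange n) _ _ ?_).symm
  rintro ⟨p, τ⟩
  have h1 : (Matrix.vecCons X w ∘ (Equiv.Perm.decomposeFin.symm (0, τ) * p.cycleRange :
      Equiv.Perm (Fin (n + 1)))) = p.insertNth X (w ∘ τ) := by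
    rw [← Fin.cons_comp_cycleRange, Equiv.Perm.coe_mul, ← Function.comp_assoc]
    congr 1
    funext i
    refine Fin.cases ?_ (fun i => ?_) i <;> simp
  rw [h1]
  congr 1
  simp [csign, Fin.sign_cycleRange, mul_comm]

end PermSum

/-! ### Shuffle products as sums over all permutations -/

section Shuffle

variable {𝔤 N N₁ N₂ N₃ : Type*} [AddCommGroup 𝔤] [Module ℂ 𝔤]
  [AddCommGroup N] [Module ℂ N] [AddCommGroup N₁] [Module ℂ N₁] [AddCommGroup N₂] [Module ℂ N₂]
  [AddCommGroup N₃] [Module ℂ N₃]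

/-- The value of `f (a _) (b _)` on the first `k` and the last `l` entries of `v`. -/
def blockEval (f : N₁ →ₗ[ℂ] N₂ →ₗ[ℂ] N₃) {k l n : ℕ} (h : k + l = n)
    (a : 𝔤 [⋀^Fin k]→ₗ[ℂ] N₁) (b : 𝔤 [⋀^Fin l]→ₗ[ℂ] N₂) (v : Fin n → 𝔤) : N₃ :=
  f (a fun i => v (Fin.cast h (Fin.castAdd l i))) (b fun i => v (Fin.cast h (Fin.natAdd k i)))

/-- Each unshuffle stands for a coset of `S_k × S_l`, on which the signed value is constant. Summing
over the full symmetric group makes `sum_perm_cons` applicable, and the factor `k! l!` is invertible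
in `ℂ`. -/
theorem factorial_smul_shuffleProd (f : N₁ →ₗ[ℂ] N₂ →ₗ[ℂ] N₃) {k l : ℕ}
    (a : 𝔤 [⋀^Fin k]→ₗ[ℂ] N₁) (b : 𝔤 [⋀^Fin l]→ₗ[ℂ] N₂) (v : Fin (k + l) → 𝔤) :
    ((k.factorial * l.factorial : ℕ) : ℂ) • shuffleProd f k l a b v =
      ∑ σ : Equiv.Perm (Fin (k + l)), csign σ • blockEval f rfl a b (v ∘ σ) := by
  have h := congrArg (fun m => TensorProduct.lift f (m fun i => v (finSumFinEquiv i)))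
    (MultilinearMap.domCoprod_alternization_eq a b)
  simp only [Fintype.card_fin, AlternatingMap.smul_apply, map_nsmul] at h
  have h2 : shuffleProd f k l a b v =
      TensorProduct.lift f (a.domCoprod b fun i => v (finSumFinEquiv i)) := rfl
  rw [h2, Nat.cast_smul_eq_nsmul, ← h, MultilinearMap.alternatization_apply, map_sum]
  refine Fintype.sum_equiv (Equiv.permCongr finSumFinEquiv) _ _ fun σ => ?_
  rw [csign, Equiv.Perm.sign_permCongr, Units.smul_def, map_zsmul, Int.cast_smul_eq_zsmul]
  congr 1
  simp [blockEval, MultilinearMap.domCoprod_apply]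

theorem blockEval_insertNth_left (f : N₁ →ₗ[ℂ] N₂ →ₗ[ℂ] N₃) {k l n : ℕ}
    (h : k + 1 + l = n + 1) (h' : k + l = n)
    (a : 𝔤 [⋀^Fin (k + 1)]→ₗ[ℂ] N₁) (b : 𝔤 [⋀^Fin l]→ₗ[ℂ] N₂) (X : 𝔤) (u : Fin n → 𝔤)
    (i : Fin (k + 1)) :
    blockEval f h a b ((Fin.cast h (Fin.castAdd l i)).insertNth X u) =
      (-1 : ℂ) ^ (i : ℕ) • blockEval f h' (a.curryLeft X) b u := by
  have h1 : (fun j => (Fin.insertNth (α := fun _ => 𝔤) (Fin.cast h (Fin.castAdd l i)) X u)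
      (Fin.cast h (Fin.castAdd l j))) =
      Fin.insertNth (α := fun _ => 𝔤) i X (fun j => u (Fin.cast h' (Fin.castAdd l j))) := by
    funext j
    rcases Fin.eq_self_or_eq_succAbove i j with rfl | ⟨j, rfl⟩
    · simp
    · have : Fin.cast h (Fin.castAdd l (i.succAbove j)) =
          (Fin.cast h (Fin.castAdd l i)).succAbove (Fin.cast h' (Fin.castAdd l j)) := by
        ext
        simp only [Fin.succAbove, Fin.lt_def, Fin.val_cast, Fin.val_castAdd, Fin.val_castSucc]
        split <;> simp
      rw [this]
      simp
  have h2 : (fun j => (Fin.insertNth (α := fun _ => 𝔤) (Fin.cast h (Fin.castAdd l i)) X u)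
      (Fin.cast h (Fin.natAdd (k + 1) j))) = fun j => u (Fin.cast h' (Fin.natAdd k j)) := by
    funext j
    have : Fin.cast h (Fin.natAdd (k + 1) j) =
          (Fin.cast h (Fin.castAdd l i)).succAbove (Fin.cast h' (Fin.natAdd k j)) := by
      ext
      have := i.2
      simp only [Fin.succAbove, Fin.lt_def, Fin.val_cast, Fin.val_castAdd, Fin.val_castSucc,
        Fin.val_natAdd]
      split <;> simp <;> omega
    rw [this]
    simp
  simp only [blockEval]
  rw [h1, h2, AlternatingMap.map_insertNth]
  rw [← Int.cast_smul_eq_zsmul ℂ]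
  simp [← AlternatingMap.curryLeft_apply_apply]

/-- Within its own block, `X` passes only `i` arguments, although its global position is `k + i`.
The missing `(-1)^k` reappears as `eps` in `iota_prod`. -/
theorem blockEval_insertNth_right (f : N₁ →ₗ[ℂ] N₂ →ₗ[ℂ] N₃) {k l n : ℕ}
    (h : k + (l + 1) = n + 1) (h' : k + l = n)
    (a : 𝔤 [⋀^Fin k]→ₗ[ℂ] N₁) (b : 𝔤 [⋀^Fin (l + 1)]→ₗ[ℂ] N₂) (X : 𝔤) (u : Fin n → 𝔤)
    (i : Fin (l + 1)) :
    blockEval f h a b ((Fin.cast h (Fin.natAdd k i)).insertNth X u) =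
      (-1 : ℂ) ^ (i : ℕ) • blockEval f h' a (b.curryLeft X) u := by
  have h1 : (fun j => (Fin.insertNth (α := fun _ => 𝔤) (Fin.cast h (Fin.natAdd k i)) X u)
      (Fin.cast h (Fin.natAdd k j))) =
      Fin.insertNth (α := fun _ => 𝔤) i X (fun j => u (Fin.cast h' (Fin.natAdd k j))) := by
    funext j
    rcases Fin.eq_self_or_eq_succAbove i j with rfl | ⟨j, rfl⟩
    · simp
    · have : Fin.cast h (Fin.natAdd k (i.succAbove j)) =
          (Fin.cast h (Fin.natAdd k i)).succAbove (Fin.cast h' (Fin.natAdd k j)) := by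
        ext
        simp only [Fin.succAbove, Fin.lt_def, Fin.val_cast, Fin.val_natAdd, Fin.val_castSucc]
        split <;> split <;> simp <;> omega
      rw [this]
      simp
  have h2 : (fun j => (Fin.insertNth (α := fun _ => 𝔤) (Fin.cast h (Fin.natAdd k i)) X u)
      (Fin.cast h (Fin.castAdd (l + 1) j))) = fun j => u (Fin.cast h' (Fin.castAdd l j)) := by
    funext j
    have : Fin.cast h (Fin.castAdd (l + 1) j) =
          (Fin.cast h (Fin.natAdd k i)).succAbove (Fin.cast h' (Fin.castAdd l j)) := by
      ext
      have := j.2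
      simp only [Fin.succAbove, Fin.lt_def, Fin.val_cast, Fin.val_castAdd, Fin.val_castSucc,
        Fin.val_natAdd]
      split <;> simp; omega
    rw [this]
    simp
  simp only [blockEval]
  rw [h1, h2, AlternatingMap.map_insertNth]
  rw [← Int.cast_smul_eq_zsmul ℂ]
  simp [← AlternatingMap.curryLeft_apply_apply]

end Shuffle

/-! ### Interior products, parity, gradient and product of vector-valued forms -/

section Calculus

variable {𝔤 N N₁ N₂ N₃ N₄ : Type*} [AddCommGroup 𝔤] [Module ℂ 𝔤]
  [AddCommGroup N] [Module ℂ N] [AddCommGroup N₁] [Module ℂ N₁] [AddCommGroup N₂] [Module ℂ N₂]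
  [AddCommGroup N₃] [Module ℂ N₃] [AddCommGroup N₄] [Module ℂ N₄]

theorem Skew.lift_of (f : (k : ℕ) → (𝔤 [⋀^Fin k]→ₗ[ℂ] N) →ₗ[ℂ] N₁) (k : ℕ)
    (a : 𝔤 [⋀^Fin k]→ₗ[ℂ] N) : Skew.lift f (Skew.of k a) = f k a :=
  DirectSum.toModule_lof (R := ℂ) (φ := f) k a

theorem Skew.component_of_self (k : ℕ) (a : 𝔤 [⋀^Fin k]→ₗ[ℂ] N) :
    Skew.component k (Skew.of k a) = a :=
  DirectSum.component.lof_self ℂ (M := fun k => 𝔤 [⋀^Fin k]→ₗ[ℂ] N) k a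

theorem Skew.component_of_of_ne {k l : ℕ} (h : k ≠ l) (a : 𝔤 [⋀^Fin k]→ₗ[ℂ] N) :
    Skew.component l (Skew.of k a) = 0 := by
  have := DirectSum.component.of ℂ (M := fun k => 𝔤 [⋀^Fin k]→ₗ[ℂ] N) l k a
  rw [dif_neg h] at this
  exact this

theorem Skew.ext_component {x y : Skew 𝔤 N} (h : ∀ k, Skew.component k x = Skew.component k y) :
    x = y :=
  DirectSum.ext_component ℂ h

theorem Skew.induction_of {P : Skew 𝔤 N → Prop} (add : ∀ x y, P x → P y → P (x + y))
    (of : ∀ k a, P (Skew.of k a)) (x : Skew 𝔤 N) : P x :=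
  DirectSum.induction_on x ((map_zero (Skew.of (𝔤 := 𝔤) (N := N) 0)) ▸ of 0 0) of add

/-- The interior product on vector-valued forms. -/
def iota : 𝔤 →ₗ[ℂ] Skew 𝔤 N →ₗ[ℂ] Skew 𝔤 N :=
  LinearMap.flip <| Skew.lift fun k => match k with
    | 0 => 0
    | k + 1 => (AlternatingMap.curryLeftLinearMap (R := ℂ) (M := 𝔤) (N := N) (n := k)).compr₂
        (Skew.of k)

theorem iota_of_zero (X : 𝔤) (a : 𝔤 [⋀^Fin 0]→ₗ[ℂ] N) : iota X (Skew.of 0 a) = 0 := by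
  simp [iota, Skew.lift_of]

theorem iota_of_succ (X : 𝔤) (k : ℕ) (a : 𝔤 [⋀^Fin (k + 1)]→ₗ[ℂ] N) :
    iota X (Skew.of (k + 1) a) = Skew.of k (a.curryLeft X) := by
  simp [iota, Skew.lift_of]

theorem contract_eq_iota (X : 𝔤) : contract X = iota (N := ℂ) X := by
  ext x
  induction x using Skew.induction_of with
  | add x y hx hy => rw [map_add, map_add, hx, hy]
  | of k a =>
    rw [contract, Skew.lift_of]
    cases k with
    | zero => rw [iota_of_zero]; rfl
    | succ k => rw [iota_of_succ]; rfl

theorem component_iota (k : ℕ) (X : 𝔤) (x : Skew 𝔤 N) :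
    Skew.component k (iota X x) = (Skew.component (k + 1) x).curryLeft X := by
  induction x using Skew.induction_of with
  | add x y hx hy => simp only [map_add, hx, hy, AlternatingMap.curryLeft_add, LinearMap.add_apply]
  | of l a =>
    cases l with
    | zero =>
      rw [iota_of_zero, Skew.component_of_of_ne (by simp), map_zero]
      simp
    | succ l =>
      rw [iota_of_succ]
      by_cases h : l = k
      · subst h
        rw [Skew.component_of_self, Skew.component_of_self]
      · rw [Skew.component_of_of_ne h, Skew.component_of_of_ne (by simpa using h)]
        simp

theorem component_succ_vecCons (k : ℕ) (X : 𝔤) (v : Fin k → 𝔤) (x : Skew 𝔤 N) :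
    Skew.component (k + 1) x (Matrix.vecCons X v) = Skew.component k (iota X x) v := by
  rw [component_iota]; rfl

/-- The component of degree zero, as an element of the space of values. -/
def aug : Skew 𝔤 N →ₗ[ℂ] N where
  toFun x := Skew.component 0 x Fin.elim0
  map_add' x y := by simp
  map_smul' c x := by simp

theorem component_zero_apply (x : Skew 𝔤 N) (v : Fin 0 → 𝔤) : Skew.component 0 x v = aug x := by
  rw [Subsingleton.elim v Fin.elim0]; rfl

/-- The uniqueness principle behind nearly every later identity: it replaces evaluation on arguments
by commutation relations with `iota`. -/
theorem Skew.ext_iota {x y : Skew 𝔤 N} (h0 : aug x = aug y) (h : ∀ X, iota X x = iota X y) :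
    x = y := by
  refine Skew.ext_component fun k => ?_
  ext v
  cases k with
  | zero => rw [component_zero_apply, component_zero_apply, h0]
  | succ k =>
    have hv : v = Matrix.vecCons (v 0) (Matrix.vecTail v) := (Matrix.cons_head_tail v).symm
    rw [hv, component_succ_vecCons, component_succ_vecCons, h]

theorem Skew.induction_iota {P : Skew 𝔤 N → Prop} (add : ∀ x y, P x → P y → P (x + y))
    (zero : ∀ a, P (Skew.of 0 a)) (iota : ∀ x, (∀ X, P (iota X x)) → P x) (x : Skew 𝔤 N) : P x := by
  refine Skew.induction_of add (fun k => ?_) x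
  induction k with
  | zero => exact zero
  | succ k ih => exact fun a => iota _ fun X => by rw [iota_of_succ]; exact ih _

/-- A linear operator that commutes with interior products up to a scalar
and has no component of degree zero vanishes. -/
theorem eq_zero_of_iota_comm (c : ℂ) (S : Skew 𝔤 N →ₗ[ℂ] Skew 𝔤 N₁)
    (h0 : ∀ x, aug (S x) = 0) (h : ∀ X x, iota X (S x) = c • S (iota X x)) (x : Skew 𝔤 N) :
    S x = 0 := by
  induction x using Skew.induction_iota with
  | add x y hx hy => rw [map_add, hx, hy, add_zero]
  | zero a =>
    refine Skew.ext_iota (by rw [h0, map_zero]) fun X => ?_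
    rw [h, iota_of_zero, map_zero, smul_zero, map_zero]
  | iota x hx =>
    refine Skew.ext_iota (by rw [h0, map_zero]) fun X => ?_
    rw [h, hx, smul_zero, map_zero]

/-- The parity operator. -/
def eps : Skew 𝔤 N →ₗ[ℂ] Skew 𝔤 N :=
  Skew.lift fun k => ((-1 : ℂ) ^ k) • Skew.of k

theorem eps_of (k : ℕ) (a : 𝔤 [⋀^Fin k]→ₗ[ℂ] N) :
    eps (Skew.of k a) = (-1 : ℂ) ^ k • Skew.of k a := by
  simp [eps, Skew.lift_of]

theorem aug_of_zero (a : 𝔤 [⋀^Fin 0]→ₗ[ℂ] N) : aug (Skew.of 0 a) = a Fin.elim0 := by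
  simp [aug, Skew.component_of_self]

theorem aug_of_succ (k : ℕ) (a : 𝔤 [⋀^Fin (k + 1)]→ₗ[ℂ] N) : aug (Skew.of (k + 1) a) = 0 := by
  simp [aug, Skew.component_of_of_ne]

theorem iota_eps (X : 𝔤) (x : Skew 𝔤 N) : iota X (eps x) = -eps (iota X x) := by
  induction x using Skew.induction_of with
  | add x y hx hy => simp only [map_add, hx, hy, neg_add]
  | of k a => cases k <;> simp [eps_of, iota_of_zero, iota_of_succ, pow_succ]

theorem eps_eps (x : Skew 𝔤 N) : eps (eps x) = x := by
  induction x using Skew.induction_of with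
  | add x y hx hy => simp only [map_add, hx, hy]
  | of k a => simp [eps_of, smul_smul, ← mul_pow]

theorem iota_iota (X Y : 𝔤) (x : Skew 𝔤 N) : iota X (iota Y x) = -iota Y (iota X x) := by
  rw [eq_neg_iff_add_eq_zero]
  have key : ∀ Z : 𝔤, iota Z (iota Z x) = 0 := by
    intro Z
    induction x using Skew.induction_of with
    | add x y hx hy => simp only [map_add, hx, hy, add_zero]
    | of k a =>
      rcases k with _ | _ | k
      · simp [iota_of_zero]
      · simp [iota_of_zero, iota_of_succ]
      · rw [iota_of_succ, iota_of_succ, AlternatingMap.curryLeft_same, map_zero]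
  -- Polarisation of `ι_Z ι_Z = 0`.
  have h := key (X + Y)
  simpa [key] using h

/-- Composition of a form with a linear map on its values. -/
def post (h : N →ₗ[ℂ] N₁) : Skew 𝔤 N →ₗ[ℂ] Skew 𝔤 N₁ :=
  Skew.lift fun k => Skew.of k ∘ₗ
    { toFun := fun a => h.compAlternatingMap a
      map_add' := fun a b => by ext; simp
      map_smul' := fun c a => by ext; simp }

theorem post_of (h : N →ₗ[ℂ] N₁) (k : ℕ) (a : 𝔤 [⋀^Fin k]→ₗ[ℂ] N) :
    post h (Skew.of k a) = Skew.of k (h.compAlternatingMap a) := by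
  rw [post, Skew.lift_of]; rfl

theorem component_post (h : N →ₗ[ℂ] N₁) (k : ℕ) (x : Skew 𝔤 N) (v : Fin k → 𝔤) :
    Skew.component k (post h x) v = h (Skew.component k x v) := by
  induction x using Skew.induction_of with
  | add x y hx hy => simp only [map_add, AlternatingMap.add_apply, hx, hy]
  | of l a =>
    rw [post_of]
    by_cases hl : l = k
    · subst hl
      simp [Skew.component_of_self]
    · simp [Skew.component_of_of_ne hl]

theorem aug_post (h : N →ₗ[ℂ] N₁) (x : Skew 𝔤 N) : aug (post h x) = h (aug x) :=
  component_post h 0 x _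

theorem iota_post (X : 𝔤) (h : N →ₗ[ℂ] N₁) (x : Skew 𝔤 N) :
    iota X (post h x) = post h (iota X x) := by
  induction x using Skew.induction_of with
  | add x y hx hy => simp only [map_add, hx, hy]
  | of k a => cases k <;> simp [post_of, iota_of_zero, iota_of_succ]

theorem eps_post (h : N →ₗ[ℂ] N₁) (x : Skew 𝔤 N) : eps (post h x) = post h (eps x) := by
  induction x using Skew.induction_of with
  | add x y hx hy => simp only [map_add, hx, hy]
  | of k a => simp [post_of, eps_of]

theorem Skew.ext_post {x y : Skew 𝔤 N} {ι : Type*} (h : ι → N →ₗ[ℂ] N₁)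
    (hh : ∀ n n' : N, (∀ i, h i n = h i n') → n = n')
    (H : ∀ i, post (h i) x = post (h i) y) : x = y := by
  refine Skew.ext_component fun k => ?_
  ext v
  refine hh _ _ fun i => ?_
  rw [← component_post, ← component_post, H]

theorem post_add (h h' : N →ₗ[ℂ] N₁) (x : Skew 𝔤 N) :
    post (h + h') x = post h x + post h' x := by
  refine Skew.ext_component fun k => ?_
  ext v
  simp [component_post]

theorem post_smul (c : ℂ) (h : N →ₗ[ℂ] N₁) (x : Skew 𝔤 N) :
    post (c • h) x = c • post h x := by
  refine Skew.ext_component fun k => ?_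
  ext v
  simp [component_post]

theorem post_post (h : N₁ →ₗ[ℂ] N₂) (h' : N →ₗ[ℂ] N₁) (x : Skew 𝔤 N) :
    post h (post h' x) = post (h ∘ₗ h') x := by
  refine Skew.ext_component fun k => ?_
  ext v
  simp [component_post]

theorem post_neg (h : N →ₗ[ℂ] N₁) (x : Skew 𝔤 N) : post (-h) x = -post h x := by
  refine Skew.ext_component fun k => ?_
  ext v
  simp [component_post]

theorem post_id (x : Skew 𝔤 N) : post LinearMap.id x = x := by
  refine Skew.ext_component fun k => ?_
  ext v
  simp [component_post]

/-- The form `Y ↦ (Z ↦ ι_Z a (Y))` with values in `Hom(𝔤, N)`. -/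
def grad : Skew 𝔤 N →ₗ[ℂ] Skew 𝔤 (𝔤 →ₗ[ℂ] N) :=
  Skew.lift fun k => match k with
    | 0 => 0
    | k + 1 => Skew.of k ∘ₗ flipCurry k

theorem grad_of_zero (a : 𝔤 [⋀^Fin 0]→ₗ[ℂ] N) : grad (Skew.of 0 a) = 0 := by
  simp [grad, Skew.lift_of]

theorem grad_of_succ (k : ℕ) (a : 𝔤 [⋀^Fin (k + 1)]→ₗ[ℂ] N) :
    grad (Skew.of (k + 1) a) = Skew.of k (flipCurry k a) := by
  simp [grad, Skew.lift_of]

/-- This characterises `grad`; together with `Skew.ext_apply` it reduces statements about `grad` to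
statements about `iota`. -/
theorem post_apply_grad (Z : 𝔤) (x : Skew 𝔤 N) :
    post (LinearMap.applyₗ Z) (grad x) = iota Z x := by
  induction x using Skew.induction_of with
  | add x y hx hy => simp only [map_add, hx, hy]
  | of k a =>
    cases k with
    | zero => rw [grad_of_zero, iota_of_zero, map_zero]
    | succ k => rw [grad_of_succ, iota_of_succ, post_of]; rfl

theorem Skew.ext_apply {x y : Skew 𝔤 (𝔤 →ₗ[ℂ] N)}
    (h : ∀ Z : 𝔤, post (LinearMap.applyₗ Z) x = post (LinearMap.applyₗ Z) y) : x = y :=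
  Skew.ext_post (fun Z : 𝔤 => LinearMap.applyₗ Z)
    (fun _ _ hn => LinearMap.ext fun Z => hn Z) h

theorem iota_grad (X : 𝔤) (x : Skew 𝔤 N) : iota X (grad x) = -grad (iota X x) := by
  refine Skew.ext_apply fun Z => ?_
  rw [← iota_post, post_apply_grad, map_neg, post_apply_grad, iota_iota]

theorem eps_grad (x : Skew 𝔤 N) : eps (grad x) = -grad (eps x) := by
  refine Skew.ext_apply fun Z => ?_
  rw [← eps_post, post_apply_grad, map_neg, post_apply_grad, iota_eps, neg_neg]

/-- The product of vector-valued forms induced by a bilinear map of the values. -/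
def prod (f : N₁ →ₗ[ℂ] N₂ →ₗ[ℂ] N₃) : Skew 𝔤 N₁ →ₗ[ℂ] Skew 𝔤 N₂ →ₗ[ℂ] Skew 𝔤 N₃ :=
  Skew.lift fun k => LinearMap.flip <|
    Skew.lift fun l => LinearMap.flip <|
      (shuffleProd f k l).compr₂ (Skew.of (k + l))

theorem wedge_eq_prod : wedge = prod (𝔤 := 𝔤) (LinearMap.mul ℂ ℂ) := rfl

theorem prod_of_of (f : N₁ →ₗ[ℂ] N₂ →ₗ[ℂ] N₃) (k l : ℕ)
    (a : 𝔤 [⋀^Fin k]→ₗ[ℂ] N₁) (b : 𝔤 [⋀^Fin l]→ₗ[ℂ] N₂) :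
    prod f (Skew.of k a) (Skew.of l b) = Skew.of (k + l) (shuffleProd f k l a b) := by
  simp [prod, Skew.lift_of]

theorem factorial_smul_component_prod (f : N₁ →ₗ[ℂ] N₂ →ₗ[ℂ] N₃) {k l n : ℕ} (h : k + l = n)
    (a : 𝔤 [⋀^Fin k]→ₗ[ℂ] N₁) (b : 𝔤 [⋀^Fin l]→ₗ[ℂ] N₂) (v : Fin n → 𝔤) :
    ((k.factorial * l.factorial : ℕ) : ℂ) •
        Skew.component n (prod f (Skew.of k a) (Skew.of l b)) v =
      ∑ σ : Equiv.Perm (Fin n), csign σ • blockEval f h a b (v ∘ σ) := by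
  subst h
  rw [prod_of_of, Skew.component_of_self, factorial_smul_shuffleProd]

theorem component_prod_of_ne (f : N₁ →ₗ[ℂ] N₂ →ₗ[ℂ] N₃) {k l n : ℕ} (h : k + l ≠ n)
    (a : 𝔤 [⋀^Fin k]→ₗ[ℂ] N₁) (b : 𝔤 [⋀^Fin l]→ₗ[ℂ] N₂) :
    Skew.component n (prod f (Skew.of k a) (Skew.of l b)) = 0 := by
  rw [prod_of_of, Skew.component_of_of_ne h]

theorem factorial_smul_component_prod_iota_left (f : N₁ →ₗ[ℂ] N₂ →ₗ[ℂ] N₃) {k l n : ℕ}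
    (h : k + l = n + 1) (a : 𝔤 [⋀^Fin k]→ₗ[ℂ] N₁) (b : 𝔤 [⋀^Fin l]→ₗ[ℂ] N₂) (X : 𝔤)
    (v : Fin n → 𝔤) :
    ((k.factorial * l.factorial : ℕ) : ℂ) •
        Skew.component n (prod f (iota X (Skew.of k a)) (Skew.of l b)) v =
      ∑ i : Fin k, ∑ τ : Equiv.Perm (Fin n), ((-1 : ℂ) ^ (i : ℕ) * csign τ) •
        blockEval f h a b ((Fin.cast h (Fin.castAdd l i)).insertNth X (v ∘ τ)) := by
  cases k with
  | zero => simp [iota_of_zero]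
  | succ k =>
    have h' : k + l = n := by omega
    have : ∀ (i : Fin (k + 1)) (τ : Equiv.Perm (Fin n)), ((-1 : ℂ) ^ (i : ℕ) * csign τ) •
        blockEval f h a b ((Fin.cast h (Fin.castAdd l i)).insertNth X (v ∘ τ)) =
        csign τ • blockEval f h' (a.curryLeft X) b (v ∘ τ) := by
      intro i τ
      rw [blockEval_insertNth_left f h h', smul_smul, mul_right_comm, ← mul_pow]
      simp
    simp only [this, Finset.sum_const, Finset.card_univ, Fintype.card_fin]
    rw [← factorial_smul_component_prod, iota_of_succ, ← Nat.cast_smul_eq_nsmul ℂ, smul_smul,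
      Nat.factorial_succ]
    push_cast
    ring_nf

theorem factorial_smul_component_prod_iota_right (f : N₁ →ₗ[ℂ] N₂ →ₗ[ℂ] N₃) {k l n : ℕ}
    (h : k + l = n + 1) (a : 𝔤 [⋀^Fin k]→ₗ[ℂ] N₁) (b : 𝔤 [⋀^Fin l]→ₗ[ℂ] N₂) (X : 𝔤)
    (v : Fin n → 𝔤) :
    ((k.factorial * l.factorial : ℕ) : ℂ) •
        Skew.component n (prod f (Skew.of k a) (iota X (Skew.of l b))) v =
      ∑ i : Fin l, ∑ τ : Equiv.Perm (Fin n), ((-1 : ℂ) ^ (i : ℕ) * csign τ) •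
        blockEval f h a b ((Fin.cast h (Fin.natAdd k i)).insertNth X (v ∘ τ)) := by
  cases l with
  | zero => simp [iota_of_zero]
  | succ l =>
    have h' : k + l = n := by omega
    have : ∀ (i : Fin (l + 1)) (τ : Equiv.Perm (Fin n)), ((-1 : ℂ) ^ (i : ℕ) * csign τ) •
        blockEval f h a b ((Fin.cast h (Fin.natAdd k i)).insertNth X (v ∘ τ)) =
        csign τ • blockEval f h' a (b.curryLeft X) (v ∘ τ) := by
      intro i τ
      rw [blockEval_insertNth_right f h h', smul_smul, mul_right_comm, ← mul_pow]
      simp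
    simp only [this, Finset.sum_const, Finset.card_univ, Fintype.card_fin]
    rw [← factorial_smul_component_prod, iota_of_succ, ← Nat.cast_smul_eq_nsmul ℂ, smul_smul,
      Nat.factorial_succ]
    push_cast
    ring_nf

/-- Interior products are antiderivations. -/
theorem iota_prod (f : N₁ →ₗ[ℂ] N₂ →ₗ[ℂ] N₃) (X : 𝔤) (x : Skew 𝔤 N₁) (y : Skew 𝔤 N₂) :
    iota X (prod f x y) = prod f (iota X x) y + prod f (eps x) (iota X y) := by
  induction x using Skew.induction_of with
  | add x x' hx hx' => simp only [map_add, LinearMap.add_apply, hx, hx']; abel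
  | of k a =>
  induction y using Skew.induction_of with
  | add y y' hy hy' => simp only [map_add, hy, hy']; abel
  | of l b =>
  refine Skew.ext_component fun n => ?_
  ext v
  rw [← component_succ_vecCons]
  by_cases h : k + l = n + 1
  · have hf : ((k.factorial * l.factorial : ℕ) : ℂ) ≠ 0 := by
      exact_mod_cast (Nat.mul_pos k.factorial_pos l.factorial_pos).ne'
    refine smul_right_injective _ hf ?_
    simp only [map_add, AlternatingMap.add_apply, smul_add, eps_of, map_smul, LinearMap.smul_apply,
      AlternatingMap.smul_apply]
    rw [smul_comm _ ((-1 : ℂ) ^ k), factorial_smul_component_prod f h,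
      factorial_smul_component_prod_iota_left f h, factorial_smul_component_prod_iota_right f h,
      sum_perm_cons (fun v => blockEval f h a b v)]
    -- The position of `X` lies in the first block or in the second; the two cases are the two
    -- Leibniz terms.
    rw [← (finSumFinEquiv.trans (finCongr h)).sum_comp, Fintype.sum_sum_type, Finset.smul_sum]
    simp only [Finset.smul_sum, smul_smul]
    simp [pow_add, mul_assoc]
  · have h1 : Skew.component n (prod f (iota X (Skew.of k a)) (Skew.of l b)) = 0 := by
      cases k with
      | zero => simp [iota_of_zero]
      | succ k => rw [iota_of_succ, component_prod_of_ne _ (by omega)]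
    have h2 : Skew.component n (prod f (Skew.of k a) (iota X (Skew.of l b))) = 0 := by
      cases l with
      | zero => simp [iota_of_zero]
      | succ l => rw [iota_of_succ, component_prod_of_ne _ (by omega)]
    simp [component_prod_of_ne f h, eps_of, h1, h2]

theorem aug_prod (f : N₁ →ₗ[ℂ] N₂ →ₗ[ℂ] N₃) (x : Skew 𝔤 N₁) (y : Skew 𝔤 N₂) :
    aug (prod f x y) = f (aug x) (aug y) := by
  induction x using Skew.induction_of with
  | add x x' hx hx' => simp only [map_add, LinearMap.add_apply, hx, hx']
  | of k a =>
  induction y using Skew.induction_of with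
  | add y y' hy hy' => simp only [map_add, hy, hy']
  | of l b =>
  by_cases h : k + l = 0
  · obtain ⟨rfl, rfl⟩ : k = 0 ∧ l = 0 := by omega
    have := factorial_smul_component_prod f h a b Fin.elim0
    rw [component_zero_apply] at this
    simp only [Nat.factorial_zero, mul_one, Nat.cast_one, one_smul] at this
    rw [this, aug_of_zero, aug_of_zero]
    simp only [Finset.univ_unique, Finset.sum_singleton, blockEval]
    simp [csign, Subsingleton.elim _ (Fin.elim0 : Fin 0 → 𝔤)]
  · have h1 : aug (prod f (Skew.of k a) (Skew.of l b)) = 0 := by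
      rw [← component_zero_apply _ Fin.elim0, component_prod_of_ne _ h, AlternatingMap.zero_apply]
    rw [h1]
    rcases k with _ | k
    · rcases l with _ | l
      · omega
      · rw [aug_of_succ, map_zero]
    · rw [aug_of_succ, map_zero, LinearMap.zero_apply]

theorem eps_prod (f : N₁ →ₗ[ℂ] N₂ →ₗ[ℂ] N₃) (x : Skew 𝔤 N₁) (y : Skew 𝔤 N₂) :
    eps (prod f x y) = prod f (eps x) (eps y) := by
  induction x using Skew.induction_of with
  | add x x' hx hx' => simp only [map_add, LinearMap.add_apply, hx, hx']
  | of k a =>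
  induction y using Skew.induction_of with
  | add y y' hy hy' => simp only [map_add, hy, hy']
  | of l b => simp [prod_of_of, eps_of, smul_smul, pow_add, mul_comm]

/-- A bilinear operator that is compatible with interior products like a product, up to a scalar,
and has no component of degree zero vanishes. -/
theorem eq_zero_of_iota_leibniz (c : ℂ) (T : Skew 𝔤 N₁ →ₗ[ℂ] Skew 𝔤 N₂ →ₗ[ℂ] Skew 𝔤 N₃)
    (h0 : ∀ x y, aug (T x y) = 0)
    (h : ∀ X x y, iota X (T x y) = c • (T (iota X x) y + T (eps x) (iota X y)))
    (x : Skew 𝔤 N₁) (y : Skew 𝔤 N₂) : T x y = 0 := by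
  -- Induction on the total degree, which drops by one in both terms of the rule `h`.
  have key : ∀ n k l : ℕ, k + l = n → ∀ (a : 𝔤 [⋀^Fin k]→ₗ[ℂ] N₁) (b : 𝔤 [⋀^Fin l]→ₗ[ℂ] N₂),
      T (Skew.of k a) (Skew.of l b) = 0 := by
    intro n
    induction n with
    | zero =>
      intro k l hkl a b
      obtain ⟨rfl, rfl⟩ : k = 0 ∧ l = 0 := by omega
      refine Skew.ext_iota (by rw [h0, map_zero]) fun X => ?_
      simp [h, iota_of_zero]
    | succ n ih =>
      intro k l hkl a b
      refine Skew.ext_iota (by rw [h0, map_zero]) fun X => ?_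
      have h1 : T (iota X (Skew.of k a)) (Skew.of l b) = 0 := by
        cases k with
        | zero => simp [iota_of_zero]
        | succ k => rw [iota_of_succ, ih k l (by omega)]
      have h2 : T (Skew.of k a) (iota X (Skew.of l b)) = 0 := by
        cases l with
        | zero => simp [iota_of_zero]
        | succ l => rw [iota_of_succ, ih k l (by omega)]
      simp [h, h1, h2, eps_of]
  induction x using Skew.induction_of with
  | add x x' hx hx' => simp only [map_add, LinearMap.add_apply, hx, hx', add_zero]
  | of k a =>
  induction y using Skew.induction_of with
  | add y y' hy hy' => simp only [map_add, hy, hy', add_zero]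
  | of l b => exact key _ k l rfl a b

theorem prod_comm (f : N₁ →ₗ[ℂ] N₂ →ₗ[ℂ] N₃) (n : ℕ) : ∀ (k l : ℕ), k + l = n →
    ∀ (a : 𝔤 [⋀^Fin k]→ₗ[ℂ] N₁) (b : 𝔤 [⋀^Fin l]→ₗ[ℂ] N₂),
    prod f (Skew.of k a) (Skew.of l b) =
      (-1 : ℂ) ^ (k * l) • prod f.flip (Skew.of l b) (Skew.of k a) := by
  induction n with
  | zero =>
    intro k l hkl a b
    obtain ⟨rfl, rfl⟩ : k = 0 ∧ l = 0 := by omega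
    refine Skew.ext_iota ?_ fun X => ?_
    · simp [aug_prod]
    · simp [iota_prod, iota_of_zero]
  | succ n ih =>
    intro k l hkl a b
    refine Skew.ext_iota ?_ fun X => ?_
    · rcases k with _ | k
      · simp [aug_prod]
      · simp [aug_prod, aug_of_succ]
    · have h1 : prod f (iota X (Skew.of k a)) (Skew.of l b) = ((-1 : ℂ) ^ (k * l) * (-1) ^ l) •
          prod f.flip (Skew.of l b) (iota X (Skew.of k a)) := by
        cases k with
        | zero => simp [iota_of_zero]
        | succ k =>
          rw [iota_of_succ, ih k l (by omega)]
          congr 1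
          rw [add_mul, pow_add, one_mul, mul_assoc, ← mul_pow]
          simp
      have h2 : (-1 : ℂ) ^ k • prod f (Skew.of k a) (iota X (Skew.of l b)) = (-1 : ℂ) ^ (k * l) •
          prod f.flip (iota X (Skew.of l b)) (Skew.of k a) := by
        cases l with
        | zero => simp [iota_of_zero]
        | succ l =>
          rw [iota_of_succ, ih k l (by omega), smul_smul]
          congr 1
          rw [mul_add, pow_add, mul_one, mul_comm]
      simp only [iota_prod, eps_of, map_smul, LinearMap.smul_apply, h1, h2, smul_add, smul_smul]
      abel

end Calculus

/-! ### Comparison principles for operators; constants and one-forms -/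

section Calculus

variable {𝔤 N N₁ N₂ N₃ N₄ : Type*} [AddCommGroup 𝔤] [Module ℂ 𝔤]
  [AddCommGroup N] [Module ℂ N] [AddCommGroup N₁] [Module ℂ N₁] [AddCommGroup N₂] [Module ℂ N₂]
  [AddCommGroup N₃] [Module ℂ N₃] [AddCommGroup N₄] [Module ℂ N₄]

theorem linear_ext_of_iota_comm (c : ℂ) (S S' : Skew 𝔤 N →ₗ[ℂ] Skew 𝔤 N₁)
    (h0 : ∀ x, aug (S x) = aug (S' x)) (h : ∀ X x, iota X (S x) = c • S (iota X x))
    (h' : ∀ X x, iota X (S' x) = c • S' (iota X x)) (x : Skew 𝔤 N) : S x = S' x := by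
  rw [← sub_eq_zero]
  refine eq_zero_of_iota_comm c (S - S') (fun x => ?_) (fun X x => ?_) x
  · simp [h0]
  · simp [h, h', smul_sub]

theorem bilinear_ext_of_iota_leibniz (c : ℂ)
    (T T' : Skew 𝔤 N₁ →ₗ[ℂ] Skew 𝔤 N₂ →ₗ[ℂ] Skew 𝔤 N₃)
    (h0 : ∀ x y, aug (T x y) = aug (T' x y))
    (h : ∀ X x y, iota X (T x y) = c • (T (iota X x) y + T (eps x) (iota X y)))
    (h' : ∀ X x y, iota X (T' x y) = c • (T' (iota X x) y + T' (eps x) (iota X y)))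
    (x : Skew 𝔤 N₁) (y : Skew 𝔤 N₂) : T x y = T' x y := by
  rw [← sub_eq_zero]
  refine eq_zero_of_iota_leibniz c (T - T') (fun x y => ?_) (fun X x y => ?_) x y
  · simp [h0]
  · simp only [LinearMap.sub_apply, map_sub, h, h', smul_add, smul_sub]
    abel

theorem prod_post_left (f : N₁ →ₗ[ℂ] N₂ →ₗ[ℂ] N₃) (g : N →ₗ[ℂ] N₁) (x : Skew 𝔤 N)
    (y : Skew 𝔤 N₂) : prod f (post g x) y = prod (f ∘ₗ g) x y := by
  refine bilinear_ext_of_iota_leibniz 1 (prod f ∘ₗ post g) (prod (f ∘ₗ g)) ?_ ?_ ?_ x y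
  · intro x y; simp [aug_prod, aug_post]
  · intro X x y; simp [iota_prod, iota_post, eps_post]
  · intro X x y; simp [iota_prod]

theorem prod_post_right (f : N₁ →ₗ[ℂ] N₂ →ₗ[ℂ] N₃) (g : N →ₗ[ℂ] N₂) (x : Skew 𝔤 N₁)
    (y : Skew 𝔤 N) : prod f x (post g y) = prod (f.compl₂ g) x y := by
  refine bilinear_ext_of_iota_leibniz 1 ((prod f).compl₂ (post g)) (prod (f.compl₂ g))
    ?_ ?_ ?_ x y
  · intro x y; simp [aug_prod, aug_post]
  · intro X x y; simp [iota_prod, iota_post]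
  · intro X x y; simp [iota_prod]

theorem post_prod (f : N₁ →ₗ[ℂ] N₂ →ₗ[ℂ] N₃) (g : N₃ →ₗ[ℂ] N) (x : Skew 𝔤 N₁)
    (y : Skew 𝔤 N₂) : post g (prod f x y) = prod (f.compr₂ g) x y := by
  refine bilinear_ext_of_iota_leibniz 1 ((prod f).compr₂ (post g)) (prod (f.compr₂ g))
    ?_ ?_ ?_ x y
  · intro x y; simp [aug_prod, aug_post]
  · intro X x y; simp [iota_prod, iota_post]
  · intro X x y; simp [iota_prod]

theorem prod_neg (f : N₁ →ₗ[ℂ] N₂ →ₗ[ℂ] N₃) (x : Skew 𝔤 N₁) (y : Skew 𝔤 N₂) :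
    prod (-f) x y = -prod f x y := by
  refine bilinear_ext_of_iota_leibniz 1 (prod (-f)) (-prod f) ?_ ?_ ?_ x y
  · intro x y; simp [aug_prod]
  · intro X x y; simp [iota_prod]
  · intro X x y; simp [iota_prod, add_comm]

/-- The form of degree zero with a given value. -/
def const (n : N) : Skew 𝔤 N := Skew.of 0 (AlternatingMap.constOfIsEmpty ℂ 𝔤 (Fin 0) n)

/-- A linear map as a form of degree one. -/
def oneForm (T : 𝔤 →ₗ[ℂ] N) : Skew 𝔤 N :=
  Skew.of 1 (AlternatingMap.ofSubsingleton ℂ 𝔤 N (0 : Fin 1) T)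

theorem aug_const (n : N) : aug (const (𝔤 := 𝔤) n) = n := by
  simp [const, aug_of_zero]

theorem iota_const (X : 𝔤) (n : N) : iota X (const n) = 0 := iota_of_zero _ _

theorem eps_const (n : N) : eps (const (𝔤 := 𝔤) n) = const n := by simp [const, eps_of]

theorem aug_oneForm (T : 𝔤 →ₗ[ℂ] N) : aug (oneForm T) = 0 := aug_of_succ _ _

theorem iota_oneForm (X : 𝔤) (T : 𝔤 →ₗ[ℂ] N) : iota X (oneForm T) = const (T X) := by
  rw [oneForm, iota_of_succ, const]
  congr 1

theorem eps_oneForm (T : 𝔤 →ₗ[ℂ] N) : eps (oneForm T) = -oneForm T := by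
  simp [oneForm, eps_of]

theorem post_const (h : N →ₗ[ℂ] N₁) (n : N) : post h (const (𝔤 := 𝔤) n) = const (h n) := by
  refine Skew.ext_iota ?_ fun X => ?_
  · simp [aug_post, aug_const]
  · simp [iota_post, iota_const]

theorem post_oneForm (h : N →ₗ[ℂ] N₁) (T : 𝔤 →ₗ[ℂ] N) :
    post h (oneForm T) = oneForm (h ∘ₗ T) := by
  refine Skew.ext_iota ?_ fun X => ?_
  · simp [aug_post, aug_oneForm]
  · simp [iota_post, iota_oneForm, post_const]

theorem prod_const_left (f : N₁ →ₗ[ℂ] N₂ →ₗ[ℂ] N₃) (n : N₁) (y : Skew 𝔤 N₂) :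
    prod f (const n) y = post (f n) y := by
  refine linear_ext_of_iota_comm 1 (prod f (const n)) (post (f n)) ?_ ?_ ?_ y
  · intro y; simp [aug_prod, aug_post, aug_const]
  · intro X y; simp [iota_prod, iota_const, eps_const]
  · intro X y; simp [iota_post]

theorem prod_const_right (f : N₁ →ₗ[ℂ] N₂ →ₗ[ℂ] N₃) (x : Skew 𝔤 N₁) (n : N₂) :
    prod f x (const n) = post (f.flip n) x := by
  refine linear_ext_of_iota_comm 1 ((prod f).flip (const n)) (post (f.flip n)) ?_ ?_ ?_ x
  · intro y; simp [aug_prod, aug_post, aug_const]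
  · intro X y; simp [iota_prod, iota_const]
  · intro X y; simp [iota_post]

theorem prod_oneForm_left (f : N₁ →ₗ[ℂ] N₂ →ₗ[ℂ] N₃) (T : 𝔤 →ₗ[ℂ] N₁) (y : Skew 𝔤 N₂) :
    prod f (oneForm T) y = prod f.flip (eps y) (oneForm T) := by
  induction y using Skew.induction_of with
  | add y y' hy hy' => simp only [map_add, LinearMap.add_apply, hy, hy']
  | of l b =>
    rw [oneForm, prod_comm f _ 1 l rfl, eps_of, one_mul, map_smul, LinearMap.smul_apply]

variable (𝔤 N) in
/-- The evaluation pairing of `𝔤` with `Hom(𝔤, N)`. -/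
def evalHom : 𝔤 →ₗ[ℂ] (𝔤 →ₗ[ℂ] N) →ₗ[ℂ] N :=
  (LinearMap.id : (𝔤 →ₗ[ℂ] N) →ₗ[ℂ] (𝔤 →ₗ[ℂ] N)).flip

@[simp]
theorem evalHom_apply (X : 𝔤) (T : 𝔤 →ₗ[ℂ] N) : evalHom 𝔤 N X T = T X := rfl

theorem post_evalHom_grad (X : 𝔤) (x : Skew 𝔤 N) : post (evalHom 𝔤 N X) (grad x) = iota X x :=
  post_apply_grad X x

end Calculus

/-! ### Lie derivatives, the two Chevalley–Eilenberg differentials, and the bracket -/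

section Lie

variable {𝔤 N N₁ N₂ N₃ : Type*} [LieRing 𝔤] [LieAlgebra ℂ 𝔤]
  [AddCommGroup N] [Module ℂ N] [AddCommGroup N₁] [Module ℂ N₁] [AddCommGroup N₂] [Module ℂ N₂]
  [AddCommGroup N₃] [Module ℂ N₃]

variable (𝔤) in
/-- The Lie bracket as a bilinear map. -/
def bracket : 𝔤 →ₗ[ℂ] 𝔤 →ₗ[ℂ] 𝔤 :=
  LinearMap.mk₂ ℂ (fun X Y => ⁅X, Y⁆) add_lie smul_lie lie_add fun c X Y => lie_smul c X Y

@[simp]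
theorem bracket_apply (X Y : 𝔤) : bracket 𝔤 X Y = ⁅X, Y⁆ := rfl

/-- The Lie derivative for the trivial action on the values. -/
def theta (X : 𝔤) : Skew 𝔤 N →ₗ[ℂ] Skew 𝔤 N :=
  -(prod (evalHom 𝔤 N) (oneForm (bracket 𝔤 X)) ∘ₗ grad)

theorem theta_apply (X : 𝔤) (x : Skew 𝔤 N) :
    theta X x = -prod (evalHom 𝔤 N) (oneForm (bracket 𝔤 X)) (grad x) := rfl

theorem aug_theta (X : 𝔤) (x : Skew 𝔤 N) : aug (theta X x) = 0 := by
  simp [theta_apply, aug_prod, aug_oneForm]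

theorem iota_theta (X Y : 𝔤) (x : Skew 𝔤 N) :
    iota Y (theta X x) = theta X (iota Y x) - iota ⁅X, Y⁆ x := by
  simp only [theta_apply, map_neg, iota_prod, iota_oneForm, eps_oneForm, iota_grad, prod_const_left,
    bracket_apply, post_evalHom_grad, LinearMap.neg_apply, neg_neg]
  abel

theorem eps_theta (X : 𝔤) (x : Skew 𝔤 N) : eps (theta X x) = theta X (eps x) := by
  simp [theta_apply, eps_prod, eps_oneForm, eps_grad]

theorem theta_post (X : 𝔤) (h : N →ₗ[ℂ] N₁) (x : Skew 𝔤 N) :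
    theta X (post h x) = post h (theta X x) := by
  rw [← sub_eq_zero]
  induction x using Skew.induction_iota with
  | add x y hx hy =>
    rw [map_add, map_add, map_add, map_add, add_sub_add_comm, hx, hy, add_zero]
  | zero a =>
    refine Skew.ext_iota (by simp [aug_theta, aug_post]) fun Y => ?_
    simp [iota_theta, iota_post, iota_of_zero]
  | iota x hx =>
    refine Skew.ext_iota (by simp [aug_theta, aug_post]) fun Y => ?_
    have := hx Y
    rw [sub_eq_zero] at this
    simp [iota_theta, iota_post, this]

theorem theta_prod (f : N₁ →ₗ[ℂ] N₂ →ₗ[ℂ] N₃) (X : 𝔤) (x : Skew 𝔤 N₁) (y : Skew 𝔤 N₂) :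
    theta X (prod f x y) = prod f (theta X x) y + prod f x (theta X y) := by
  have key : ∀ n k l : ℕ, k + l = n → ∀ (a : 𝔤 [⋀^Fin k]→ₗ[ℂ] N₁) (b : 𝔤 [⋀^Fin l]→ₗ[ℂ] N₂),
      theta X (prod f (Skew.of k a) (Skew.of l b)) =
        prod f (theta X (Skew.of k a)) (Skew.of l b) +
          prod f (Skew.of k a) (theta X (Skew.of l b)) := by
    intro n
    induction n with
    | zero =>
      intro k l hkl a b
      obtain ⟨rfl, rfl⟩ : k = 0 ∧ l = 0 := by omega
      refine Skew.ext_iota (by simp [aug_theta, aug_prod]) fun Y => ?_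
      simp [iota_theta, iota_prod, iota_of_zero]
    | succ n ih =>
      intro k l hkl a b
      refine Skew.ext_iota (by simp [aug_theta, aug_prod]) fun Y => ?_
      have h1 : theta X (prod f (iota Y (Skew.of k a)) (Skew.of l b)) =
          prod f (theta X (iota Y (Skew.of k a))) (Skew.of l b) +
          prod f (iota Y (Skew.of k a)) (theta X (Skew.of l b)) := by
        cases k with
        | zero => simp [iota_of_zero]
        | succ k => rw [iota_of_succ, ih k l (by omega)]
      have h2 : theta X (prod f (Skew.of k a) (iota Y (Skew.of l b))) =
          prod f (theta X (Skew.of k a)) (iota Y (Skew.of l b)) +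
          prod f (Skew.of k a) (theta X (iota Y (Skew.of l b))) := by
        cases l with
        | zero => simp [iota_of_zero]
        | succ l => rw [iota_of_succ, ih k l (by omega)]
      simp only [iota_theta, iota_prod, map_add, map_sub, eps_theta, h1, h2, eps_of, map_smul,
        LinearMap.smul_apply, LinearMap.sub_apply, smul_add]
      abel
  induction x using Skew.induction_of with
  | add x x' hx hx' => simp only [map_add, LinearMap.add_apply, hx, hx']; abel
  | of k a =>
  induction y using Skew.induction_of with
  | add y y' hy hy' => simp only [map_add, hy, hy']; abel
  | of l b => exact key _ k l rfl a b

/-- The components of the Lie derivative. -/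
theorem component_theta (X : 𝔤) (k : ℕ) : ∀ (x : Skew 𝔤 N) (Y : Fin k → 𝔤),
    Skew.component k (theta X x) Y =
      -∑ i, Skew.component k x (Function.update Y i ⁅X, Y i⁆) := by
  induction k with
  | zero => intro x Y; simp [component_zero_apply, aug_theta]
  | succ k ih =>
    intro x Y
    obtain ⟨Z, v, rfl⟩ : ∃ Z v, Y = Matrix.vecCons Z v :=
      ⟨Y 0, Matrix.vecTail Y, (Matrix.cons_head_tail Y).symm⟩
    rw [component_succ_vecCons, iota_theta, map_sub, AlternatingMap.sub_apply, ih,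
      Fin.sum_univ_succ]
    simp only [Matrix.vecCons, Fin.cons_zero, Fin.update_cons_zero, Fin.cons_succ, ← Fin.cons_update]
    simp only [← Matrix.vecCons.eq_1, component_succ_vecCons]
    abel

variable (𝔤) in
/-- The Lie bracket as a form of degree two. -/
def bracketForm : Skew 𝔤 𝔤 := Skew.of 2 (lieCochain 𝔤)

theorem aug_bracketForm : aug (bracketForm 𝔤) = 0 := aug_of_succ _ _

theorem eps_bracketForm : eps (bracketForm 𝔤) = bracketForm 𝔤 := by
  simp [bracketForm, eps_of]

theorem iota_bracketForm (X : 𝔤) : iota X (bracketForm 𝔤) = oneForm (bracket 𝔤 X) := by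
  rw [bracketForm, iota_of_succ, oneForm]
  congr 1

/-- The Chevalley–Eilenberg differential for trivial coefficients. -/
def dTriv : Skew 𝔤 N →ₗ[ℂ] Skew 𝔤 N :=
  -(prod (evalHom 𝔤 N) (bracketForm 𝔤) ∘ₗ grad)

theorem dTriv_apply (x : Skew 𝔤 N) :
    dTriv x = -prod (evalHom 𝔤 N) (bracketForm 𝔤) (grad x) := rfl

theorem aug_dTriv (x : Skew 𝔤 N) : aug (dTriv x) = 0 := by
  simp [dTriv_apply, aug_prod, aug_bracketForm]

/-- Cartan's formula: `theta` and `dTriv` insert `ad X` and the bracket form into the same gradient,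
and contracting the bracket form with `X` gives `ad X`. -/
theorem iota_dTriv (X : 𝔤) (x : Skew 𝔤 N) : iota X (dTriv x) = theta X x - dTriv (iota X x) := by
  simp only [dTriv_apply, theta_apply, map_neg, iota_prod, iota_bracketForm, eps_bracketForm,
    iota_grad]
  abel

theorem eps_dTriv (x : Skew 𝔤 N) : eps (dTriv x) = -dTriv (eps x) := by
  simp [dTriv_apply, eps_prod, eps_bracketForm, eps_grad]

/-- The Lie derivative for the adjoint action on the values. -/
def lieDeriv (X : 𝔤) : Skew 𝔤 𝔤 →ₗ[ℂ] Skew 𝔤 𝔤 := post (bracket 𝔤 X) + theta X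

theorem lieDeriv_apply (X : 𝔤) (x : Skew 𝔤 𝔤) :
    lieDeriv X x = post (bracket 𝔤 X) x + theta X x := rfl

/-- The Chevalley–Eilenberg differential for the adjoint action. -/
def dAd : Skew 𝔤 𝔤 →ₗ[ℂ] Skew 𝔤 𝔤 := prod (bracket 𝔤) (oneForm LinearMap.id) + dTriv

theorem dAd_apply (x : Skew 𝔤 𝔤) :
    dAd x = prod (bracket 𝔤) (oneForm LinearMap.id) x + dTriv x := rfl

theorem aug_dAd (x : Skew 𝔤 𝔤) : aug (dAd x) = 0 := by
  simp [dAd_apply, aug_prod, aug_oneForm, aug_dTriv]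

theorem aug_lieDeriv (X : 𝔤) (x : Skew 𝔤 𝔤) : aug (lieDeriv X x) = ⁅X, aug x⁆ := by
  simp [lieDeriv_apply, aug_post, aug_theta]

theorem iota_dAd (X : 𝔤) (x : Skew 𝔤 𝔤) : iota X (dAd x) = lieDeriv X x - dAd (iota X x) := by
  simp only [dAd_apply, lieDeriv_apply, map_add, iota_prod, iota_oneForm, eps_oneForm,
    prod_const_left, iota_dTriv, map_neg, LinearMap.neg_apply, LinearMap.id_apply]
  abel

theorem eps_dAd (x : Skew 𝔤 𝔤) : eps (dAd x) = -dAd (eps x) := by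
  simp only [dAd_apply, map_add, eps_prod, eps_oneForm, eps_dTriv, map_neg, LinearMap.neg_apply]
  abel

theorem eps_lieDeriv (X : 𝔤) (x : Skew 𝔤 𝔤) : eps (lieDeriv X x) = lieDeriv X (eps x) := by
  simp only [lieDeriv_apply, map_add, eps_post, eps_theta]

theorem insertion_eq (k l : ℕ) (a : 𝔤 [⋀^Fin k]→ₗ[ℂ] 𝔤) (b : 𝔤 [⋀^Fin l]→ₗ[ℂ] 𝔤) :
    insertion k l a b = prod (evalHom 𝔤 𝔤) (Skew.of l b) (grad (Skew.of k a)) := by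
  cases k with
  | zero => rw [grad_of_zero, map_zero]; rfl
  | succ k => rw [grad_of_succ, prod_of_of]; rfl

theorem gBracket_of_of (k l : ℕ) (a : 𝔤 [⋀^Fin k]→ₗ[ℂ] 𝔤) (b : 𝔤 [⋀^Fin l]→ₗ[ℂ] 𝔤) :
    gBracket (Skew.of k a) (Skew.of l b) =
      ((-1 : ℂ) ^ ((k + 1) * (l + 1))) •
          prod (evalHom 𝔤 𝔤) (Skew.of l b) (grad (Skew.of k a)) -
        prod (evalHom 𝔤 𝔤) (Skew.of k a) (grad (Skew.of l b)) := by
  rw [← insertion_eq, ← insertion_eq]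
  simp [gBracket, Skew.lift_of, gBracketAux]

theorem grad_bracketForm : grad (bracketForm 𝔤) = oneForm (-bracket 𝔤) := by
  refine Skew.ext_apply fun Z => ?_
  rw [post_apply_grad, iota_bracketForm, post_oneForm]
  congr 1
  ext Y
  simp

/-- Inserting `x` into `F₀` gives the part acting on values, and inserting `F₀` into `x` gives
`dTriv`. -/
theorem diff_eq_dAd : diff 𝔤 = dAd := by
  ext x
  induction x using Skew.induction_of with
  | add x y hx hy => rw [map_add, map_add, hx, hy]
  | of l b =>
    have h1 := gBracket_of_of 2 l (lieCochain 𝔤) b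
    rw [← bracketForm, grad_bracketForm, oneForm, prod_comm _ _ l 1 rfl, ← oneForm] at h1
    have h2 : oneForm (-bracket 𝔤) = post (-bracket 𝔤) (oneForm LinearMap.id) := by
      rw [post_oneForm, LinearMap.comp_id]
    have h3 : (evalHom 𝔤 𝔤).flip ∘ₗ (-bracket 𝔤) = -bracket 𝔤 := by
      ext X Y; simp
    -- The sign of the bracket and that of commuting `x` past a one-form combine to `-1` in every
    -- degree, cancelling the minus in `grad F₀ = -ad`.
    have h4 : (-1 : ℂ) ^ ((2 + 1) * (l + 1)) * (-1) ^ (l * 1) = -1 := by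
      rw [← pow_add]
      refine Odd.neg_one_pow ⟨2 * l + 1, by ring⟩
    rw [h2, prod_post_left, h3, prod_neg, smul_smul, h4] at h1
    rw [dAd_apply, dTriv_apply]
    simpa [diff, bracketForm, sub_eq_add_neg] using h1

end Lie

/-! ### Invariant scalar forms are closed -/

section Trivial

variable {𝔤 N N₁ N₂ N₃ : Type*} [LieRing 𝔤] [LieAlgebra ℂ 𝔤]
  [AddCommGroup N] [Module ℂ N] [AddCommGroup N₁] [Module ℂ N₁] [AddCommGroup N₂] [Module ℂ N₂]
  [AddCommGroup N₃] [Module ℂ N₃]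

theorem theta_const (X : 𝔤) (n : N) : theta X (const n) = 0 := by
  refine Skew.ext_iota (by simp [aug_theta]) fun Y => ?_
  simp [iota_theta, iota_const]

theorem theta_add_left (X X' : 𝔤) (x : Skew 𝔤 N) : theta (X + X') x = theta X x + theta X' x := by
  refine Skew.ext_component fun k => ?_
  ext Y
  simp only [component_theta, map_add, AlternatingMap.add_apply, add_lie,
    AlternatingMap.map_update_add, Finset.sum_add_distrib, neg_add]

theorem theta_smul_left (c : ℂ) (X : 𝔤) (x : Skew 𝔤 N) : theta (c • X) x = c • theta X x := by
  refine Skew.ext_component fun k => ?_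
  ext Y
  simp only [component_theta, map_smul, AlternatingMap.smul_apply, smul_lie,
    AlternatingMap.map_update_smul, Finset.smul_sum, smul_neg]

theorem prod_sum {J : Type*} (s : Finset J) (f : J → N₁ →ₗ[ℂ] N₂ →ₗ[ℂ] N₃) (x : Skew 𝔤 N₁)
    (y : Skew 𝔤 N₂) : prod (∑ j ∈ s, f j) x y = ∑ j ∈ s, prod (f j) x y := by
  have := bilinear_ext_of_iota_leibniz 1 (prod (𝔤 := 𝔤) (∑ j ∈ s, f j)) (∑ j ∈ s, prod (f j))
    ?_ ?_ ?_ x y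
  · simpa using this
  · intro x y; simp [aug_prod]
  · intro X x y; simp [iota_prod]
  · intro X x y; simp [iota_prod, Finset.sum_add_distrib]

/-- Expanding `Y` in the basis gives `∑ⱼ b^j(Y) [bⱼ, X] = -[X, Y]`, so the sum is insertion of `-ad
X`. -/
theorem sum_prod_coord_iota_bracket {J : Type*} [Fintype J] (b : Module.Basis J ℂ 𝔤) (X : 𝔤)
    (x : Skew 𝔤 ℂ) :
    ∑ j, prod (LinearMap.mul ℂ ℂ) (oneForm (b.coord j)) (iota ⁅b j, X⁆ x) = theta X x := by
  have h : ∀ j, prod (LinearMap.mul ℂ ℂ) (oneForm (b.coord j)) (iota ⁅b j, X⁆ x) =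
      prod (((LinearMap.mul ℂ ℂ).compl₂ (evalHom 𝔤 ℂ ⁅b j, X⁆)) ∘ₗ b.coord j)
        (oneForm LinearMap.id) (grad x) := by
    intro j
    rw [← prod_post_left, post_oneForm, ← prod_post_right, post_evalHom_grad, LinearMap.comp_id]
  have h2 : oneForm (bracket 𝔤 X) = post (bracket 𝔤 X) (oneForm LinearMap.id) := by
    rw [post_oneForm, LinearMap.comp_id]
  rw [Finset.sum_congr rfl fun j _ => h j, ← prod_sum, theta_apply, h2, prod_post_left, ← prod_neg]
  congr 3
  ext Y T
  have hY : Y = ∑ j, b.coord j Y • b j := (b.sum_repr Y).symm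
  conv_rhs => rw [hY]
  simp only [LinearMap.sum_apply, LinearMap.coe_comp, Function.comp_apply, LinearMap.compl₂_apply,
    LinearMap.mul_apply', evalHom_apply, LinearMap.neg_apply, bracket_apply, map_sum,
    map_smul, LinearMap.smul_apply, smul_eq_mul]
  refine Finset.sum_congr rfl fun j _ => ?_
  rw [← lie_skew, map_neg]

/-- Twice the differential is `∑ⱼ b^j ∧ θ_{bⱼ}`. -/
theorem two_smul_dTriv {J : Type*} [Fintype J] (b : Module.Basis J ℂ 𝔤) (x : Skew 𝔤 ℂ) :
    (2 : ℂ) • dTriv x =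
      ∑ j, prod (LinearMap.mul ℂ ℂ) (oneForm (b.coord j)) (theta (b j) x) := by
  let E : Skew 𝔤 ℂ →ₗ[ℂ] Skew 𝔤 ℂ :=
    (2 : ℂ) • dTriv - ∑ j, prod (LinearMap.mul ℂ ℂ) (oneForm (b.coord j)) ∘ₗ theta (b j)
  have hE : ∀ x, E x = (2 : ℂ) • dTriv x -
      ∑ j, prod (LinearMap.mul ℂ ℂ) (oneForm (b.coord j)) (theta (b j) x) := by
    intro x; simp [E]
  rw [← sub_eq_zero, ← hE]
  -- The defect `E` anticommutes with `ι_X`: contracting the `b^j` yields one `θ_X`, the commutators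
  -- of `ι_X` with `θ_{bⱼ}` yield another, and these match the `2θ_X` from Cartan's formula.
  refine eq_zero_of_iota_comm (-1) E (fun x => ?_) (fun X x => ?_) x
  · simp [hE, aug_dTriv, aug_prod, aug_oneForm]
  · have h1 : ∑ j, post (LinearMap.mul ℂ ℂ (b.coord j X)) (theta (b j) x) = theta X x := by
      have : ∀ c : ℂ, LinearMap.mul ℂ ℂ c = c • LinearMap.id := by intro c; ext; simp
      simp only [this, post_smul, post_id, ← theta_smul_left]
      have hX : theta X x = theta (∑ j, b.coord j X • b j) x := by
        congr 2
        exact (b.sum_repr X).symm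
      rw [hX]
      exact (map_sum (AddMonoidHom.mk' (fun X => theta X x) fun X X' => theta_add_left X X' x)
        _ _).symm
    simp only [hE, map_sub, map_smul, map_sum, iota_dTriv, iota_prod, iota_oneForm, eps_oneForm,
      prod_const_left, iota_theta, map_neg, LinearMap.neg_apply, Finset.sum_add_distrib, h1,
      Finset.sum_neg_distrib, Finset.sum_sub_distrib, sum_prod_coord_iota_bracket]
    module

theorem dTriv_eq_zero_of_theta [FiniteDimensional ℂ 𝔤] {x : Skew 𝔤 ℂ}
    (h : ∀ X, theta X x = 0) : dTriv x = 0 := by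
  have := two_smul_dTriv (Module.finBasis ℂ 𝔤) x
  simpa [h] using this

/-! ### The Casimir homotopy on the adjoint complex -/

/-- Invariance of the Casimir element `∑ⱼ eⱼ ⊗ e'ⱼ`, tested on bilinear maps. -/
def IsInvariantPair {J : Type*} [Fintype J] (e e' : J → 𝔤) : Prop :=
  ∀ (β : 𝔤 →ₗ[ℂ] 𝔤 →ₗ[ℂ] Skew 𝔤 𝔤) (X : 𝔤), ∑ j, (β ⁅X, e j⁆ (e' j) + β (e j) ⁅X, e' j⁆) = 0

/-- The contracting homotopy built from a Casimir element. -/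
def homotopy {J : Type*} [Fintype J] (e e' : J → 𝔤) : Skew 𝔤 𝔤 →ₗ[ℂ] Skew 𝔤 𝔤 :=
  ∑ j, post (bracket 𝔤 (e j)) ∘ₗ iota (e' j)

theorem homotopy_apply {J : Type*} [Fintype J] (e e' : J → 𝔤) (x : Skew 𝔤 𝔤) :
    homotopy e e' x = ∑ j, post (bracket 𝔤 (e j)) (iota (e' j) x) := by
  simp [homotopy]

theorem iota_homotopy {J : Type*} [Fintype J] (e e' : J → 𝔤) (X : 𝔤) (x : Skew 𝔤 𝔤) :
    iota X (homotopy e e' x) = -homotopy e e' (iota X x) := by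
  simp only [homotopy_apply, map_sum, iota_post, iota_iota X, map_neg, Finset.sum_neg_distrib]

theorem lieDeriv_homotopy {J : Type*} [Fintype J] {e e' : J → 𝔤} (h : IsInvariantPair e e')
    (X : 𝔤) (x : Skew 𝔤 𝔤) :
    lieDeriv X (homotopy e e' x) = homotopy e e' (lieDeriv X x) := by
  -- For this `β`, the sum in `IsInvariantPair` is exactly the commutator of `lieDeriv X` with the
  -- homotopy, applied to `x`.
  let β : 𝔤 →ₗ[ℂ] 𝔤 →ₗ[ℂ] Skew 𝔤 𝔤 := LinearMap.mk₂ ℂ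
    (fun Y Z => post (bracket 𝔤 Y) (iota Z x))
    (fun Y Y' Z => by rw [map_add, post_add]) (fun c Y Z => by rw [map_smul, post_smul])
    (fun Y Z Z' => by simp) (fun c Y Z => by simp)
  have hβ := h β X
  rw [← sub_eq_zero, ← hβ]
  simp only [homotopy_apply, map_sum, ← Finset.sum_sub_distrib]
  refine Finset.sum_congr rfl fun j _ => ?_
  have h1 : bracket 𝔤 X ∘ₗ bracket 𝔤 (e j) =
      bracket 𝔤 ⁅X, e j⁆ + bracket 𝔤 (e j) ∘ₗ bracket 𝔤 X := by
    ext Z; simp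
  simp only [β, LinearMap.mk₂_apply, lieDeriv_apply, theta_post, map_add, iota_post, iota_theta,
    post_post, h1, post_add]
  simp only [map_sub]
  abel

/-- By Cartan's formula and equivariance of the homotopy, `d h + h d` commutes with every `ι_X`. It
is therefore determined by its degree-zero part, which is the Casimir acting on `𝔤`. -/
theorem dAd_homotopy {J : Type*} [Fintype J] {e e' : J → 𝔤} (h : IsInvariantPair e e')
    (hc : ∀ Z : 𝔤, ∑ j, ⁅e j, ⁅e' j, Z⁆⁆ = Z) (x : Skew 𝔤 𝔤) :
    dAd (homotopy e e' x) + homotopy e e' (dAd x) = x := by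
  refine linear_ext_of_iota_comm 1 (dAd ∘ₗ homotopy e e' + homotopy e e' ∘ₗ dAd) LinearMap.id
    (fun x => ?_) (fun X x => ?_) (fun X x => by simp) x
  · simp [homotopy_apply, aug_dAd, aug_post, iota_dAd, aug_lieDeriv, hc]
  · simp only [LinearMap.add_apply, LinearMap.comp_apply, map_add, iota_dAd, iota_homotopy, map_neg,
      lieDeriv_homotopy h, map_sub, one_smul]
    abel

/-- A Killing-orthonormal basis is used rather than a `B`-orthonormal one: the Killing form is the
trace form of the adjoint representation, which is what normalises its Casimir to the identity
there. -/
theorem exists_casimir [FiniteDimensional ℂ 𝔤] [LieAlgebra.IsSemisimple ℂ 𝔤] :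
    ∃ e : Fin (Module.finrank ℂ 𝔤) → 𝔤, IsInvariantPair e e ∧ ∀ Z : 𝔤, ∑ j, ⁅e j, ⁅e j, Z⁆⁆ = Z := by
  have hn := LieAlgebra.IsKilling.killingForm_nondegenerate ℂ 𝔤
  have hs : ∀ x y, killingForm ℂ 𝔤 x y = killingForm ℂ 𝔤 y x := LieModule.traceForm_comm ℂ 𝔤 𝔤
  have hi : ∀ x y z, killingForm ℂ 𝔤 ⁅x, y⁆ z = killingForm ℂ 𝔤 x ⁅y, z⁆ :=
    LieModule.traceForm_apply_lie_apply ℂ 𝔤 𝔤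
  obtain ⟨b, hb⟩ := exists_isOrthonormalBasis (killingForm ℂ 𝔤) ⟨hs⟩ hn
  have hb' : ∀ i j, killingForm ℂ 𝔤 (b i) (b j) = if i = j then 1 else 0 := by
    intro i j
    split
    · next h => subst h; exact hb.1 i
    · next h => exact hb.2 i j h
  have hr : ∀ x j, b.repr x j = killingForm ℂ 𝔤 x (b j) := by
    intro x j
    conv_rhs => rw [← b.sum_repr x]
    simp only [map_sum, map_smul, LinearMap.sum_apply, LinearMap.smul_apply, hb', smul_eq_mul,
      mul_ite, mul_one, mul_zero, Finset.sum_ite_eq', Finset.mem_univ, if_true]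
  refine ⟨b, ?_, ?_⟩
  · intro β X
    have h1 : ∀ j, β ⁅X, b j⁆ (b j) =
        ∑ i, killingForm ℂ 𝔤 ⁅X, b j⁆ (b i) • β (b i) (b j) := by
      intro j
      conv_lhs => rw [← b.sum_repr ⁅X, b j⁆]
      simp [hr]
    have h2 : ∀ j, β (b j) ⁅X, b j⁆ =
        ∑ i, killingForm ℂ 𝔤 ⁅X, b j⁆ (b i) • β (b j) (b i) := by
      intro j
      conv_lhs => rw [← b.sum_repr ⁅X, b j⁆]
      simp [hr]
    simp only [h1, h2, Finset.sum_add_distrib]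
    -- After exchanging the indices, the coefficients cancel because `ad X` is skew for the Killing
    -- form.
    rw [Finset.sum_comm, ← Finset.sum_add_distrib]
    refine Finset.sum_eq_zero fun j _ => ?_
    rw [← Finset.sum_add_distrib]
    refine Finset.sum_eq_zero fun i _ => ?_
    rw [← add_smul]
    have : killingForm ℂ 𝔤 ⁅X, b i⁆ (b j) + killingForm ℂ 𝔤 ⁅X, b j⁆ (b i) = 0 := by
      rw [← lie_skew, map_neg, LinearMap.neg_apply, hi, hs ⁅X, b j⁆ (b i), neg_add_cancel]
    rw [this, zero_smul]
  · intro Z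
    rw [← sub_eq_zero]
    refine hn.1 _ fun W => ?_
    -- The trace of `ad Z ∘ ad W`, computed in the orthonormal basis.
    have ht : killingForm ℂ 𝔤 Z W = ∑ j, killingForm ℂ 𝔤 ⁅Z, ⁅W, b j⁆⁆ (b j) := by
      rw [killingForm_apply_apply, LinearMap.trace_eq_matrix_trace ℂ b, Matrix.trace]
      simp [LinearMap.toMatrix_apply, hr]
    rw [map_sub, LinearMap.sub_apply, sub_eq_zero, ht, map_sum, LinearMap.sum_apply]
    refine Finset.sum_congr rfl fun j _ => ?_
    have h1 : killingForm ℂ 𝔤 ⁅b j, ⁅b j, Z⁆⁆ W = -killingForm ℂ 𝔤 ⁅b j, Z⁆ ⁅b j, W⁆ := by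
      rw [← lie_skew (b j) ⁅b j, Z⁆, map_neg, LinearMap.neg_apply, hi]
    have h2 : killingForm ℂ 𝔤 ⁅Z, ⁅W, b j⁆⁆ (b j) = -killingForm ℂ 𝔤 ⁅b j, W⁆ ⁅b j, Z⁆ := by
      rw [← lie_skew Z ⁅W, b j⁆, map_neg, LinearMap.neg_apply, hi, ← lie_skew W (b j),
        ← lie_skew Z (b j), map_neg, map_neg, LinearMap.neg_apply, neg_neg]
    rw [h1, h2, hs]

end Trivial

/-! ### The Leibniz rule for the pairing by `B` -/

section Form

variable {𝔤 : Type*} [LieRing 𝔤] [LieAlgebra ℂ 𝔤]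

theorem theta_prod_form {B : LinearMap.BilinForm ℂ 𝔤} (hB : B.lieInvariant 𝔤) (X : 𝔤)
    (x y : Skew 𝔤 𝔤) :
    theta X (prod B x y) = prod B (lieDeriv X x) y + prod B x (lieDeriv X y) := by
  have h : B ∘ₗ bracket 𝔤 X = -B.compl₂ (bracket 𝔤 X) := by
    ext Y Z
    exact hB X Y Z
  rw [theta_prod, lieDeriv_apply, lieDeriv_apply, map_add, map_add, LinearMap.add_apply,
    prod_post_left, prod_post_right, h, prod_neg]
  abel

theorem dTriv_prod_form {B : LinearMap.BilinForm ℂ 𝔤} (hB : B.lieInvariant 𝔤) (x y : Skew 𝔤 𝔤) :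
    dTriv (prod B x y) = prod B (dAd x) y + prod B (eps x) (dAd y) := by
  let T : Skew 𝔤 𝔤 →ₗ[ℂ] Skew 𝔤 𝔤 →ₗ[ℂ] Skew 𝔤 ℂ :=
    (prod B).compr₂ dTriv - prod B ∘ₗ dAd - (prod B ∘ₗ eps).compl₂ dAd
  have hT : ∀ x y, T x y = dTriv (prod B x y) - prod B (dAd x) y - prod B (eps x) (dAd y) := by
    intro x y; simp [T]
  -- The Lie derivative terms cancel by `theta_prod_form`; the scalar `-1` is the sign that `d` and
  -- `eps` acquire when passing `ι_X`.
  have := eq_zero_of_iota_leibniz (-1) T (fun x y => ?_) (fun X x y => ?_) x y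
  · rw [hT, sub_sub, sub_eq_zero] at this
    exact this
  · simp [hT, aug_dTriv, aug_prod, aug_dAd]
  · simp only [hT, map_sub, map_add, iota_dTriv, iota_prod, theta_prod_form hB, iota_dAd, eps_dAd,
      iota_eps, eps_eps, map_neg, LinearMap.neg_apply, LinearMap.sub_apply]
    module

theorem dAd_const (Z : 𝔤) : dAd (const Z) = oneForm (-bracket 𝔤 Z) := by
  refine Skew.ext_iota (by simp [aug_dAd, aug_oneForm]) fun X => ?_
  simp [iota_dAd, iota_const, iota_oneForm, lieDeriv_apply, theta_const, post_const]

theorem prod_iota_comm {N₁ N₂ N₃ : Type*} [AddCommGroup N₁] [Module ℂ N₁] [AddCommGroup N₂]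
    [Module ℂ N₂] [AddCommGroup N₃] [Module ℂ N₃] (f : N₁ →ₗ[ℂ] N₂ →ₗ[ℂ] N₃) (k l : ℕ)
    (a : 𝔤 [⋀^Fin k]→ₗ[ℂ] N₁) (b : 𝔤 [⋀^Fin l]→ₗ[ℂ] N₂) (X : 𝔤) :
    prod f (iota X (Skew.of k a)) (Skew.of l b) = ((-1 : ℂ) ^ (k * l) * (-1) ^ l) •
      prod f.flip (Skew.of l b) (iota X (Skew.of k a)) := by
  cases k with
  | zero => simp [iota_of_zero]
  | succ k =>
    rw [iota_of_succ, prod_comm f _ k l rfl]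
    congr 1
    rw [add_mul, pow_add, one_mul, mul_assoc, ← mul_pow]
    simp

theorem eq_dAd_homotopy {J : Type*} [Fintype J] {e : J → 𝔤} (h : IsInvariantPair e e)
    (hc : ∀ Z : 𝔤, ∑ j, ⁅e j, ⁅e j, Z⁆⁆ = Z) {x : Skew 𝔤 𝔤} (hx : dAd x = 0) :
    dAd (homotopy e e x) = x := by
  have := dAd_homotopy h hc x
  rwa [hx, map_zero, add_zero] at this

theorem theta_eq_zero_of_isInvariantForm {x : Skew 𝔤 ℂ} (hx : IsInvariantForm x) (X : 𝔤) :
    theta X x = 0 := by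
  refine Skew.ext_component fun k => ?_
  ext Y
  rw [component_theta, hx X k Y, map_zero, AlternatingMap.zero_apply]

theorem Skew.ext_flip {B : LinearMap.BilinForm ℂ 𝔤} (hn : B.Nondegenerate) {x y : Skew 𝔤 𝔤} (h : ∀ Z, post ((LinearMap.flip B) Z) x = post ((LinearMap.flip B) Z) y) :
    x = y := by
  refine Skew.ext_post (fun Z => (LinearMap.flip B) Z) (fun n n' hnn => ?_) h
  rw [← sub_eq_zero]
  refine hn.1 _ fun Z => ?_
  have := hnn Z
  simp only [LinearMap.flip_apply] at this
  simp [this]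

/-- The pairing of closed cochains is exact. -/
theorem prod_form_eq_dTriv {B : LinearMap.BilinForm ℂ 𝔤} (hB : B.lieInvariant 𝔤) {J : Type*} [Fintype J] {e : J → 𝔤}
    (h : IsInvariantPair e e) (hc : ∀ Z : 𝔤, ∑ j, ⁅e j, ⁅e j, Z⁆⁆ = Z) {x y : Skew 𝔤 𝔤}
    (hx : dAd x = 0) (hy : dAd y = 0) :
    prod B (eps x) y = -dTriv (prod B (eps (homotopy e e x)) y) := by
  rw [dTriv_prod_form hB, hy, map_zero, add_zero]
  have := eps_dAd (homotopy e e x)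
  rw [eq_dAd_homotopy h hc hx] at this
  rw [this, map_neg, LinearMap.neg_apply]

/-! ### The map `sharp` and the two brackets -/

/-- The cochain `C` with `B (C (Y₁, …, Yₖ), Z) = Ω (Z, Y₁, …, Yₖ)`. -/
def sharp [FiniteDimensional ℂ 𝔤] (B : LinearMap.BilinForm ℂ 𝔤) (hn : B.Nondegenerate) :
    Skew 𝔤 ℂ →ₗ[ℂ] Skew 𝔤 𝔤 :=
  post (LinearMap.BilinForm.toDual B hn).symm.toLinearMap ∘ₗ grad

variable [FiniteDimensional ℂ 𝔤] {B : LinearMap.BilinForm ℂ 𝔤} (hn : B.Nondegenerate)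

theorem sharp_apply (x : Skew 𝔤 ℂ) :
    sharp B hn x = post (LinearMap.BilinForm.toDual B hn).symm.toLinearMap (grad x) := rfl

theorem form_toDual_symm (φ : 𝔤 →ₗ[ℂ] ℂ) (Z : 𝔤) :
    B ((LinearMap.BilinForm.toDual B hn).symm φ) Z = φ Z := by
  exact LinearMap.BilinForm.apply_toDual_symm_apply (hB := hn) φ Z

/-- This determines `sharp`: by `Skew.ext_flip`, identities about it are tested by pairing with each
`Z`. -/
theorem post_flip_sharp (Z : 𝔤) (x : Skew 𝔤 ℂ) : post ((LinearMap.flip B) Z) (sharp B hn x) = iota Z x := by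
  rw [sharp_apply, post_post, ← post_evalHom_grad]
  congr 2
  ext φ
  exact form_toDual_symm hn φ Z

theorem eps_sharp (x : Skew 𝔤 ℂ) : eps (sharp B hn x) = -sharp B hn (eps x) := by
  rw [sharp_apply, eps_post, eps_grad, map_neg, sharp_apply]

theorem prod_eps_sharp_dAd_const (Z : 𝔤) (x : Skew 𝔤 ℂ) :
    prod B (eps (sharp B hn x)) (dAd (const Z)) = theta Z x := by
  have h : ((LinearMap.flip B).compl₂ (LinearMap.BilinForm.toDual B hn).symm.toLinearMap) = evalHom 𝔤 ℂ := by
    ext Y φ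
    exact form_toDual_symm hn φ Y
  have h2 := prod_oneForm_left (LinearMap.flip B) (-bracket 𝔤 Z) (sharp B hn x)
  rw [LinearMap.flip_flip] at h2
  have h3 : oneForm (-bracket 𝔤 Z) = -oneForm (bracket 𝔤 Z) := by
    refine Skew.ext_iota (by simp [aug_oneForm]) fun X => ?_
    rw [map_neg, iota_oneForm, iota_oneForm]
    refine Skew.ext_iota (by simp [aug_const]) fun X => ?_
    simp [iota_const]
  rw [dAd_const, ← h2, h3, sharp_apply, prod_post_right, h, map_neg, LinearMap.neg_apply,
    theta_apply]

/-- Leibniz for `B(x♯, Z)` with `Z` constant gives `d ι_Z x = B(d x♯, Z) + θ_Z x`; Cartan's formula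
turns this into `B(d x♯, Z) = -ι_Z d x`. -/
theorem dAd_sharp (hB : B.lieInvariant 𝔤) (x : Skew 𝔤 ℂ) :
    dAd (sharp B hn x) = -sharp B hn (dTriv x) := by
  refine Skew.ext_flip hn fun Z => ?_
  have h := dTriv_prod_form hB (sharp B hn x) (const Z)
  rw [prod_const_right, prod_const_right, post_flip_sharp, prod_eps_sharp_dAd_const] at h
  rw [map_neg, post_flip_sharp, iota_dTriv, h]
  abel

theorem lieDeriv_sharp (hB : B.lieInvariant 𝔤) (X : 𝔤) (x : Skew 𝔤 ℂ) :
    lieDeriv X (sharp B hn x) = sharp B hn (theta X x) := by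
  refine Skew.ext_flip hn fun Z => ?_
  have h : (LinearMap.flip B) Z ∘ₗ bracket 𝔤 X = -(LinearMap.flip B) ⁅X, Z⁆ := by
    ext Y
    exact hB X Y Z
  rw [lieDeriv_apply, map_add, post_post, h, ← theta_post, post_neg, post_flip_sharp,
    post_flip_sharp, post_flip_sharp, iota_theta]
  abel

/-- Skew-symmetry of `x` exchanges the slot filled by `G` with the one paired with `Z`. Insertion of
`G` thus becomes a `B`-product. -/
theorem post_flip_prod_evalHom_grad_sharp (Z : 𝔤) (x : Skew 𝔤 ℂ) (G : Skew 𝔤 𝔤) :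
    post ((LinearMap.flip B) Z) (prod (evalHom 𝔤 𝔤) G (grad (sharp B hn x))) =
      -prod (LinearMap.flip B) G (iota Z (sharp B hn x)) := by
  let χ : (𝔤 →ₗ[ℂ] 𝔤) →ₗ[ℂ] (𝔤 →ₗ[ℂ] ℂ) := LinearMap.compRight ℂ ((LinearMap.flip B) Z)
  have h1 : (evalHom 𝔤 𝔤).compr₂ ((LinearMap.flip B) Z) = (evalHom 𝔤 ℂ).compl₂ χ := by
    ext Y T; rfl
  have h2 : post χ (grad (sharp B hn x)) = -post B (iota Z (sharp B hn x)) := by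
    refine Skew.ext_apply fun W => ?_
    have h3 : LinearMap.applyₗ W ∘ₗ χ = (LinearMap.flip B) Z ∘ₗ LinearMap.applyₗ W := by
      ext T; rfl
    have h4 : LinearMap.applyₗ W ∘ₗ B = (LinearMap.flip B) W := by
      ext T; rfl
    rw [map_neg, post_post, post_post, h3, h4, ← post_post, post_apply_grad, ← iota_post,
      ← iota_post, post_flip_sharp, post_flip_sharp, iota_iota]
  have h5 : (evalHom 𝔤 ℂ).compl₂ B = (LinearMap.flip B) := by
    ext Y n; rfl
  rw [post_prod, h1, ← prod_post_right, h2, map_neg, prod_post_right, h5]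

/-- Paired with `Z`, the two insertions in the bracket become the two Leibniz terms of `ι_Z` applied
to the pairing on the right. -/
theorem gBracket_sharp (hs : B.IsSymm) (x y : Skew 𝔤 ℂ) :
    gBracket (sharp B hn x) (sharp B hn y) =
      sharp B hn (prod B (eps (sharp B hn x)) (sharp B hn y)) := by
  have hflip : (LinearMap.flip B) = B := by
    ext X Y
    exact hs.eq Y X
  induction x using Skew.induction_of with
  | add x x' hx hx' => simp only [map_add, LinearMap.add_apply, hx, hx']
  | of k a =>
  induction y using Skew.induction_of with
  | add y y' hy hy' => simp only [map_add, hy, hy']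
  | of l b =>
  rcases k with _ | k
  · simp [sharp_apply, grad_of_zero]
  rcases l with _ | l
  · simp [sharp_apply, grad_of_zero]
  obtain ⟨a', ha⟩ : ∃ a', sharp B hn (Skew.of (k + 1) a) = Skew.of k a' :=
    ⟨_, by rw [sharp_apply, grad_of_succ, post_of]⟩
  obtain ⟨b', hb⟩ : ∃ b', sharp B hn (Skew.of (l + 1) b) = Skew.of l b' :=
    ⟨_, by rw [sharp_apply, grad_of_succ, post_of]⟩
  refine Skew.ext_flip hn fun Z => ?_
  have h1 := post_flip_prod_evalHom_grad_sharp hn Z (Skew.of (k + 1) a) (Skew.of l b')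
  have h2 := post_flip_prod_evalHom_grad_sharp hn Z (Skew.of (l + 1) b) (Skew.of k a')
  rw [ha] at h1
  rw [hb] at h2
  rw [post_flip_sharp, ha, hb, gBracket_of_of, map_sub, map_smul, h1, h2, iota_prod, eps_eps,
    eps_of, map_smul, map_smul, LinearMap.smul_apply, prod_iota_comm, hflip, smul_smul, smul_neg,
    sub_neg_eq_add, ← neg_smul]
  congr 2
  rw [← pow_add, ← pow_add, ← neg_one_mul, ← pow_succ']
  refine neg_one_pow_congr ?_
  simp only [Nat.even_add, Nat.even_mul, Nat.even_add_one]
  tauto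

theorem prod_sharp_eq_zero [LieAlgebra.IsSemisimple ℂ 𝔤] (hB : B.lieInvariant 𝔤)
    {x y : Skew 𝔤 ℂ} (hx : ∀ X, theta X x = 0) (hy : ∀ X, theta X y = 0) :
    prod B (eps (sharp B hn x)) (sharp B hn y) = 0 := by
  obtain ⟨e, he, hc⟩ := exists_casimir (𝔤 := 𝔤)
  have hdx : dAd (sharp B hn x) = 0 := by
    rw [dAd_sharp hn hB, dTriv_eq_zero_of_theta hx, map_zero, neg_zero]
  have hdy : dAd (sharp B hn y) = 0 := by
    rw [dAd_sharp hn hB, dTriv_eq_zero_of_theta hy, map_zero, neg_zero]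
  rw [prod_form_eq_dTriv hB he hc hdx hdy, dTriv_eq_zero_of_theta, neg_zero]
  intro X
  rw [theta_prod_form hB, ← eps_lieDeriv, lieDeriv_homotopy he, lieDeriv_sharp, lieDeriv_sharp, hx,
    hy]
  · simp
  · exact hB
  · exact hB

theorem sharp_eq_sum {ι : Type*} [Fintype ι] {b : Module.Basis ι ℂ 𝔤}
    (hb : IsOrthonormalBasis B b) (x : Skew 𝔤 ℂ) :
    sharp B hn x = ∑ j, post (LinearMap.toSpanSingleton ℂ 𝔤 (b j)) (iota (b j) x) := by
  classical
  have hb' : ∀ i j, B (b i) (b j) = if i = j then 1 else 0 := by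
    intro i j
    split
    · next h => subst h; exact hb.1 i
    · next h => exact hb.2 i j h
  refine Skew.ext_post (fun i => (LinearMap.flip B) (b i)) (fun n n' hnn => ?_) fun i => ?_
  · rw [← sub_eq_zero]
    refine hn.1 _ fun Z => ?_
    have : B n = B n' := b.ext hnn
    rw [map_sub, this, sub_self, LinearMap.zero_apply]
  · have : ∀ j, (LinearMap.flip B) (b i) ∘ₗ LinearMap.toSpanSingleton ℂ 𝔤 (b j) =
        (if j = i then (1 : ℂ) else 0) • LinearMap.id := by
      intro j
      ext
      rw [LinearMap.smul_apply]
      simp [hb']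
    rw [post_flip_sharp, map_sum]
    simp only [post_post, this, post_smul, post_id]
    simp only [ite_smul, one_smul, zero_smul, Finset.sum_ite_eq', Finset.mem_univ, if_true]

/-- Expanding both sharps in `b`, orthonormality leaves only the diagonal terms. The right-hand side
does not involve `b`, so the bracket is independent of the basis. -/
theorem superPoisson_eq {ι : Type*} [Fintype ι] {b : Module.Basis ι ℂ 𝔤}
    (hb : IsOrthonormalBasis B b) (x y : Skew 𝔤 ℂ) :
    superPoisson b x y = (2 : ℂ) • prod B (eps (sharp B hn x)) (sharp B hn y) := by
  classical
  have hb' : ∀ i j, B (b i) (b j) = if i = j then 1 else 0 := by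
    intro i j
    split
    · next h => subst h; exact hb.1 i
    · next h => exact hb.2 i j h
  have h1 : superPoisson b x y =
      (-2 : ℂ) • ∑ j, prod (LinearMap.mul ℂ ℂ) (iota (b j) (eps x)) (iota (b j) y) := by
    induction x using Skew.induction_of with
    | add x x' hx hx' =>
      rw [map_add, LinearMap.add_apply, hx, hx', ← smul_add, ← Finset.sum_add_distrib]
      simp only [map_add, LinearMap.add_apply]
    | of k a =>
      rw [superPoisson, Skew.lift_of]
      simp only [LinearMap.smul_apply, LinearMap.sum_apply, LinearMap.compl₁₂_apply,
        LinearMap.comp_apply, contract_eq_iota, wedge_eq_prod, eps_of, map_smul,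
        ← Finset.smul_sum, smul_smul]
      congr 1
      ring
  have h2 : ∀ i j, (B ∘ₗ LinearMap.toSpanSingleton ℂ 𝔤 (b i)).compl₂
      (LinearMap.toSpanSingleton ℂ 𝔤 (b j)) =
      if i = j then LinearMap.mul ℂ ℂ else 0 := by
    intro i j
    ext
    by_cases h : i = j <;> simp [hb', h]
  have h3 : ∀ i j : ι, prod (𝔤 := 𝔤) (if i = j then LinearMap.mul ℂ ℂ else 0) =
      if i = j then prod (LinearMap.mul ℂ ℂ) else 0 := by
    intro i j
    split
    · rfl
    · ext1 x
      ext1 y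
      simpa using prod_sum (∅ : Finset ℕ) (fun _ => LinearMap.mul ℂ ℂ) x y
  have h4 : ∀ u v : ι → Skew 𝔤 ℂ, prod B (∑ i, post (LinearMap.toSpanSingleton ℂ 𝔤 (b i)) (u i))
      (∑ j, post (LinearMap.toSpanSingleton ℂ 𝔤 (b j)) (v j)) =
      ∑ i, prod (LinearMap.mul ℂ ℂ) (u i) (v i) := by
    intro u v
    rw [map_sum]
    refine Finset.sum_congr rfl fun i _ => ?_
    rw [map_sum, LinearMap.sum_apply, Finset.sum_eq_single i]
    · rw [prod_post_left, prod_post_right, h2, if_pos rfl]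
    · intro j _ hj
      rw [prod_post_left, prod_post_right, h2, h3, if_neg hj]
      rfl
    · simp
  rw [h1, eps_sharp, sharp_eq_sum hn hb, sharp_eq_sum hn hb, map_neg, LinearMap.neg_apply, h4,
    smul_neg, neg_smul]

end Form

/-! ### Cyclic cochains and alternating forms -/

section Cyclic

variable {𝔤 : Type*} [AddCommGroup 𝔤] [Module ℂ 𝔤]

theorem alternatingMap_cons_last {N : Type*} [AddCommGroup N] [Module ℂ N] {k : ℕ}
    (f : 𝔤 [⋀^Fin (k + 1)]→ₗ[ℂ] N) (v : Fin (k + 1) → 𝔤) :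
    f (Matrix.vecCons (v (Fin.last k)) fun i => v i.castSucc) = (-1 : ℂ) ^ k • f v := by
  have h := f.neg_one_pow_smul_map_insertNth (Fin.last k) (v (Fin.last k)) fun i => v i.castSucc
  have hv : (Fin.last k).insertNth (v (Fin.last k)) (fun i => v i.castSucc) = v := by
    rw [Fin.insertNth_last']
    exact Fin.snoc_init_self v
  rw [hv, Fin.val_last] at h
  rw [← h, ← Int.cast_smul_eq_zsmul ℂ]
  simp

theorem alternatingMap_cons_removeNth {N : Type*} [AddCommGroup N] [Module ℂ N] {k : ℕ}
    (f : 𝔤 [⋀^Fin (k + 1)]→ₗ[ℂ] N) (v : Fin (k + 1) → 𝔤) (i : Fin (k + 1)) :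
    f (Matrix.vecCons (v i) (i.removeNth v)) = (-1 : ℂ) ^ (i : ℕ) • f v := by
  have h := f.neg_one_pow_smul_map_insertNth i (v i) (i.removeNth v)
  rw [Fin.insertNth_self_removeNth] at h
  rw [← h, ← Int.cast_smul_eq_zsmul ℂ]
  simp

/-- The cyclicity condition on homogeneous cochains. -/
def IsCyclic (B : LinearMap.BilinForm ℂ 𝔤) {k : ℕ} (c : 𝔤 [⋀^Fin k]→ₗ[ℂ] 𝔤) : Prop :=
  ∀ Y : Fin (k + 1) → 𝔤,
    hat B c Y = (-1) ^ k * hat B c (Fin.cons (Y (Fin.last k)) fun i => Y i.castSucc)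

/-- For the first `k` slots the sign comes from skew-symmetry of `c`; for the last slot it is the
cyclicity condition itself. -/
theorem hat_cons_removeNth {B : LinearMap.BilinForm ℂ 𝔤} {k : ℕ} {c : 𝔤 [⋀^Fin k]→ₗ[ℂ] 𝔤}
    (hc : IsCyclic B c) (v : Fin (k + 1) → 𝔤) (i : Fin (k + 1)) :
    hat B c (Fin.cons (v i) (i.removeNth v)) = (-1) ^ (i : ℕ) * hat B c v := by
  refine Fin.lastCases ?_ (fun i => ?_) i
  · rw [hc v, ← mul_assoc, Fin.val_last, ← mul_pow]
    simp [Fin.removeNth_last]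
    rfl
  · cases k with
    | zero => exact i.elim0
    | succ k =>
      have h := alternatingMap_cons_removeNth c (fun j => v j.castSucc) i
      have h1 : (fun j : Fin (k + 1) => (Fin.cons (v i.castSucc) (i.castSucc.removeNth v) :
          Fin (k + 2) → 𝔤) j.castSucc) =
          Matrix.vecCons (v i.castSucc) (i.removeNth fun j => v j.castSucc) := by
        funext j
        refine Fin.cases ?_ (fun j => ?_) j
        · simp
        · simp [Fin.removeNth, Fin.castSucc_succAbove_castSucc]
      have h2 : (Fin.cons (v i.castSucc) (i.castSucc.removeNth v) :
          Fin (k + 2) → 𝔤) (Fin.last (k + 1)) = v (Fin.last (k + 1)) := by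
        rw [← Fin.succ_last, Fin.cons_succ, Fin.removeNth,
          Fin.succAbove_castSucc_of_le _ _ (Fin.le_last _)]
      rw [hat, h1, h2, h]
      simp [hat]

/-- A cyclic cochain comes from an alternating form. -/
theorem exists_form_of_isCyclic {B : LinearMap.BilinForm ℂ 𝔤} {k : ℕ} {c : 𝔤 [⋀^Fin k]→ₗ[ℂ] 𝔤}
    (hc : IsCyclic B c) :
    ∃ ω : 𝔤 [⋀^Fin (k + 1)]→ₗ[ℂ] ℂ, ∀ Z v, ω (Matrix.vecCons Z v) = B (c v) Z := by
  let f : 𝔤 →ₗ[ℂ] 𝔤 [⋀^Fin k]→ₗ[ℂ] ℂ :=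
    { toFun := fun Z => (LinearMap.flip B Z).compAlternatingMap c
      map_add' := fun Z Z' => by ext; simp
      map_smul' := fun r Z => by ext; simp }
  have hf : ∀ (v : Fin (k + 1) → 𝔤) i,
      f (v i) (i.removeNth v) = (-1) ^ (i : ℕ) * ((-1) ^ k * hat B c v) := by
    intro v i
    have h1 : f (v i) (i.removeNth v) = hat B c (Fin.snoc (i.removeNth v) (v i)) := by
      simp [f, hat]
    rw [h1, hc]
    simp only [Fin.snoc_last, Fin.snoc_castSucc]
    rw [hat_cons_removeNth hc]
    ring
  -- By `hf` the `k + 1` terms of the alternatization are all equal, whence the normalising factor.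
  refine ⟨((k : ℂ) + 1)⁻¹ • AlternatingMap.alternatizeUncurryFin f, fun Z v => ?_⟩
  have hk : (k : ℂ) + 1 ≠ 0 := by exact_mod_cast k.succ_ne_zero
  have h0 := hf (Matrix.vecCons Z v) 0
  have h0' : B (c v) Z = (-1) ^ k * hat B c (Matrix.vecCons Z v) := by
    simpa [f] using h0
  rw [AlternatingMap.smul_apply, AlternatingMap.alternatizeUncurryFin_apply, h0']
  have : ∀ i : Fin (k + 1), (-1 : ℤ) ^ (i : ℕ) •
      f (Matrix.vecCons Z v i) (i.removeNth (Matrix.vecCons Z v)) =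
      (-1) ^ k * hat B c (Matrix.vecCons Z v) := by
    intro i
    rw [hf, ← Int.cast_smul_eq_zsmul ℂ, smul_eq_mul, ← mul_assoc]
    push_cast
    rw [← mul_pow]
    simp
  simp only [this, Finset.sum_const, Finset.card_univ, Fintype.card_fin, nsmul_eq_mul, smul_eq_mul]
  push_cast
  field_simp

end Cyclic

/-! ### Vanishing on invariant cochains and on cyclic cohomology -/

section Main

variable {𝔤 : Type*} [LieRing 𝔤] [LieAlgebra ℂ 𝔤]

theorem lieDeriv_eq_zero_of_isInvariantCochain {C : Skew 𝔤 𝔤} (hC : IsInvariantCochain C) (X : 𝔤) :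
    lieDeriv X C = 0 := by
  refine Skew.ext_component fun k => ?_
  ext Y
  rw [lieDeriv_apply, map_add, AlternatingMap.add_apply, component_theta, component_post,
    bracket_apply, ← sub_eq_add_neg, hC X k Y, map_zero, AlternatingMap.zero_apply]

variable [FiniteDimensional ℂ 𝔤] {B : LinearMap.BilinForm ℂ 𝔤} (hn : B.Nondegenerate)

theorem form_component_sharp (k : ℕ) (x : Skew 𝔤 ℂ) (v : Fin k → 𝔤) (Z : 𝔤) :
    B (Skew.component k (sharp B hn x) v) Z = Skew.component (k + 1) x (Matrix.vecCons Z v) := by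
  rw [component_succ_vecCons, ← post_flip_sharp hn, component_post, LinearMap.flip_apply]

theorem sharp_mem_cyclicCochains (x : Skew 𝔤 ℂ) : sharp B hn x ∈ cyclicCochains B := by
  intro k Y
  simp only [hat, form_component_sharp]
  rw [alternatingMap_cons_last, alternatingMap_cons_last]
  have h : (Fin.cons (Y (Fin.last k)) fun i => Y i.castSucc : Fin (k + 1) → 𝔤) =
      Matrix.vecCons (Y (Fin.last k)) fun i => Y i.castSucc := rfl
  rw [h, alternatingMap_cons_last]
  simp only [smul_eq_mul]
  rw [← mul_assoc ((-1) ^ k), ← mul_pow]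
  simp

/-- Each homogeneous component is the sharp of the form supplied by `exists_form_of_isCyclic`, and
there are finitely many nonzero components. -/
theorem exists_sharp_eq {C : Skew 𝔤 𝔤} (hC : C ∈ cyclicCochains B) : ∃ x, sharp B hn x = C := by
  have h : ∀ k, Skew.of k (Skew.component k C) ∈ LinearMap.range (sharp B hn) := by
    intro k
    obtain ⟨ω, hω⟩ := exists_form_of_isCyclic (hC k)
    refine ⟨Skew.of (k + 1) ω, ?_⟩
    refine Skew.ext_flip hn fun Z => ?_
    rw [post_flip_sharp, iota_of_succ, post_of]
    congr 1
    ext v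
    exact hω Z v
  have hsum : ∀ x : Skew 𝔤 𝔤, ∃ s : Finset ℕ, ∑ k ∈ s, Skew.of k (Skew.component k x) = x := by
    classical
    intro x
    exact ⟨_, DirectSum.sum_support_of (β := fun k => 𝔤 [⋀^Fin k]→ₗ[ℂ] 𝔤) x⟩
  obtain ⟨s, hs⟩ := hsum C
  rw [← LinearMap.mem_range, ← hs]
  exact Submodule.sum_mem _ fun k _ => h k

/-- Equivariance gives `(θ_X x)♯ = 0`. Since `sharp` loses only the degree-zero part, where `θ_X x`
vanishes anyway, `θ_X x = 0`. -/
theorem theta_eq_zero_of_sharp (hB : B.lieInvariant 𝔤) {x : Skew 𝔤 ℂ}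
    (hx : IsInvariantCochain (sharp B hn x)) (X : 𝔤) : theta X x = 0 := by
  have h := lieDeriv_eq_zero_of_isInvariantCochain hx X
  rw [lieDeriv_sharp hn hB] at h
  refine Skew.ext_iota (by rw [aug_theta, map_zero]) fun Z => ?_
  rw [← post_flip_sharp hn, h, map_zero, map_zero]

theorem gBracket_eq_zero_of_invariant [LieAlgebra.IsSemisimple ℂ 𝔤] (hs : B.IsSymm)
    (hn : B.Nondegenerate) (hB : B.lieInvariant 𝔤) {C C' : Cochains 𝔤} (hC : C ∈ cyclicCochains B)
    (hC' : C' ∈ cyclicCochains B) (hi : IsInvariantCochain C) (hi' : IsInvariantCochain C') :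
    gBracket C C' = 0 := by
  obtain ⟨x, rfl⟩ := exists_sharp_eq hn hC
  obtain ⟨y, rfl⟩ := exists_sharp_eq hn hC'
  rw [gBracket_sharp hn hs, prod_sharp_eq_zero hn hB (theta_eq_zero_of_sharp hn hB hi)
    (theta_eq_zero_of_sharp hn hB hi'), map_zero]

/-- The bracket of two cyclic cocycles is a cyclic cocycle and a cyclic coboundary. -/
theorem gBracket_mem [LieAlgebra.IsSemisimple ℂ 𝔤] (hs : B.IsSymm)
    (hn : B.Nondegenerate) (hB : B.lieInvariant 𝔤) {F G : Cochains 𝔤} (hF : F ∈ cyclicCocycles B)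
    (hG : G ∈ cyclicCocycles B) :
    gBracket F G ∈ cyclicCocycles B ∧ gBracket F G ∈ cyclicCoboundaries B := by
  obtain ⟨hF1, hF2⟩ := hF
  obtain ⟨hG1, hG2⟩ := hG
  rw [SetLike.mem_coe, LinearMap.mem_ker, diff_eq_dAd] at hF2 hG2
  obtain ⟨e, he, hc⟩ := exists_casimir (𝔤 := 𝔤)
  have hex := prod_form_eq_dTriv hB he hc hF2 hG2
  have hcl := dTriv_prod_form hB (eps F) G
  have hε : dAd (eps F) = 0 := by
    have := eps_dAd F
    rw [hF2, map_zero] at this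
    exact neg_eq_zero.mp this.symm
  rw [hε, hG2, map_zero, map_zero, LinearMap.zero_apply, add_zero] at hcl
  obtain ⟨x, hx⟩ := exists_sharp_eq hn hF1
  obtain ⟨y, hy⟩ := exists_sharp_eq hn hG1
  have hb : gBracket F G = sharp B hn (prod B (eps F) G) := by
    rw [← hx, ← hy, gBracket_sharp hn hs]
  refine ⟨⟨?_, ?_⟩, ?_⟩
  · rw [hb]
    exact sharp_mem_cyclicCochains hn _
  · rw [SetLike.mem_coe, LinearMap.mem_ker, diff_eq_dAd, hb, dAd_sharp hn hB, hcl, map_zero,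
      neg_zero]
  · refine ⟨_, sharp_mem_cyclicCochains hn (prod B (eps (homotopy e e F)) G), ?_⟩
    rw [diff_eq_dAd, dAd_sharp hn hB, hb, hex, map_neg]

/-- Every bracket of cocycles has class zero and classes of cocycles exhaust the cohomology;
existence, uniqueness and vanishing follow together. -/
theorem isInducedBracket_iff [LieAlgebra.IsSemisimple ℂ 𝔤] (hs : B.IsSymm)
    (hn : B.Nondegenerate) (hB : B.lieInvariant 𝔤)
    (β : CyclicCohomology B →ₗ[ℂ] CyclicCohomology B →ₗ[ℂ] CyclicCohomology B) :
    IsInducedBracket B β ↔ β = 0 := by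
  have key : ∀ F G : cyclicCocycles B, ∃ h : gBracket (F : Cochains 𝔤) (G : Cochains 𝔤) ∈
      cyclicCocycles B, cyclicClass B ⟨_, h⟩ = 0 := by
    intro F G
    obtain ⟨h1, h2⟩ := gBracket_mem hs hn hB F.2 G.2
    refine ⟨h1, ?_⟩
    rw [cyclicClass, Submodule.mkQ_apply, Submodule.Quotient.mk_eq_zero]
    exact h2
  constructor
  · intro h
    refine LinearMap.ext₂ fun x y => ?_
    obtain ⟨F, rfl⟩ := Submodule.mkQ_surjective _ x
    obtain ⟨G, rfl⟩ := Submodule.mkQ_surjective _ y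
    obtain ⟨h1, h2⟩ := h F G
    obtain ⟨_, h3⟩ := key F G
    exact h2.trans h3
  · rintro rfl F G
    obtain ⟨h1, h2⟩ := key F G
    exact ⟨h1, by rw [h2]; rfl⟩

end Main

end QuadraticLie

end

theorem proposition6p2p1 {𝔤 : Type*} [LieRing 𝔤] [LieAlgebra ℂ 𝔤] [FiniteDimensional ℂ 𝔤]
    [LieAlgebra.IsSemisimple ℂ 𝔤] (B : LinearMap.BilinForm ℂ 𝔤) (hB_symm : B.IsSymm)
    (hB_nondeg : B.Nondegenerate) (hB_inv : B.lieInvariant 𝔤) :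
    -- the super Poisson bracket (in any orthonormal basis) vanishes on invariant forms
    (∀ {ι : Type*} [Fintype ι] (b : Module.Basis ι ℂ 𝔤), QuadraticLie.IsOrthonormalBasis B b →
      ∀ I I' : QuadraticLie.Grassmann 𝔤,
        QuadraticLie.IsInvariantForm I → QuadraticLie.IsInvariantForm I' →
          QuadraticLie.superPoisson b I I' = 0) ∧
    -- the Gerstenhaber bracket vanishes on invariant cyclic cochains
    (∀ C ∈ QuadraticLie.cyclicCochains B, ∀ C' ∈ QuadraticLie.cyclicCochains B,
      QuadraticLie.IsInvariantCochain C → QuadraticLie.IsInvariantCochain C' →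
        QuadraticLie.gBracket C C' = 0) ∧
    -- the Gerstenhaber bracket induces a bracket on cyclic cohomology, and this bracket is zero
    (∃! β, QuadraticLie.IsInducedBracket B β) ∧
    (∀ β, QuadraticLie.IsInducedBracket B β → β = 0) := by
  refine ⟨fun b hb I I' hI hI' => ?_, fun C hC C' hC' hi hi' => ?_, ⟨0, ?_, fun β hβ => ?_⟩,
    fun β hβ => ?_⟩
  · rw [QuadraticLie.superPoisson_eq hB_nondeg hb, QuadraticLie.prod_sharp_eq_zero hB_nondeg hB_inv
      (QuadraticLie.theta_eq_zero_of_isInvariantForm hI)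
      (QuadraticLie.theta_eq_zero_of_isInvariantForm hI'), smul_zero]
  · exact QuadraticLie.gBracket_eq_zero_of_invariant hB_symm hB_nondeg hB_inv hC hC' hi hi'
  · exact (QuadraticLie.isInducedBracket_iff hB_symm hB_nondeg hB_inv 0).mpr rfl
  · exact (QuadraticLie.isInducedBracket_iff hB_symm hB_nondeg hB_inv β).mp hβ
  · exact (QuadraticLie.isInducedBracket_iff hB_symm hB_nondeg hB_inv β).mp hβ
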